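/- Let $G$ be a connected simple graph, finite or infinite, with finite maximum degree $\Delta$ and minimum degree $\delta$, such that $\delta \geq \Delta/2$ and $G \neq K_2$. An edge-coloring of $G$ with $r$ colors is an arbitrary function $E(G) \to \{1,\dots,r\}$ (adjacent edges may get the same color); it is called asymmetric if the identity is the only automorphism of $G$ that preserves the colors of all edges. The distinguishing index $D'(G)$ is the least number $r$ of colors for which $G$ has an asymmetric edge-coloring. Then $G$ admits an asymmetric edge-coloring with three colors; in particular $D'(G) \leq 3$. -/

import Mathlib

namespace SimpleGraph

/-- An edge-coloring `c` of `G` (an arbitrary function on the edges, adjacent edges may share a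
color) is asymmetric if the identity is the only automorphism of `G` that preserves the color of
every edge. -/
def IsAsymmetricEdgeColoring {V α : Type*} (G : SimpleGraph V) (c : G.edgeSet → α) : Prop :=
  ∀ φ : G ≃g G, (∀ e : G.edgeSet, c (φ.mapEdgeSet e) = c e) → φ = Iso.refl

/-- The distinguishing index of `G`: the least number `r` of colors for which `G` has an
asymmetric edge-coloring, and `⊤` if there is no such natural number. -/
noncomputable def distinguishingIndex {V : Type*} (G : SimpleGraph V) : ℕ∞ :=
  sInf {n : ℕ∞ | ∃ r : ℕ, n = r ∧ ∃ c : G.edgeSet → Fin r, G.IsAsymmetricEdgeColoring c}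

end SimpleGraph

/-!
Colours are the three signs, and the colour of the edge `ab` is `w a b` for a symmetric function `w`.
The weight of a vertex is the sum of the signs of its edges.

Let `δ` be at least `3`. Starting from a root `v₀` of degree `δ`, a growing set `X` of processed
vertices is kept such that every colour preserving automorphism fixing `v₀` fixes `X` pointwise,
however the edges disjoint from `X` are coloured. Such an automorphism permutes each class of
unprocessed vertices that have the same degree and the same coloured adjacencies to `X`. The key
invariant `ClassBound` says that a class of at least two vertices with `a ≥ 1` neighbours in `X` has
at most `δ - a` elements. So a member of a class of `m` vertices which has `c` non-neighbours among
the other members has at least `c + 1` edges to vertices outside `X` and the class.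
That is enough to give all members different weights (`exists_process_class`): colour the edges
inside the class as a threshold graph, which yields the inner sums `0, -1, …, 1 - m` up to an error
between `0` and `c + 1` at each member, and let the outgoing edges of each member absorb the
error. These edges can at the same time be coloured such that no other class with at least two
members, met in at least two vertices, is met in one colour only (`exists_flexible_sum`), so that
the invariant survives: one more neighbour in `X` costs the class at least one member. A vertex
which has no neighbour in `X` before gets its first one `u`; as `u` has at most `Δ - 1 ≤ 2 δ - 1`
such neighbours, three colours split them into parts of size at most `δ - 1`. This is where the
hypothesis on the degrees and the third colour are used.

The root has to be recognizable and its neighbours have to satisfy the invariant at the start. If `G`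
is not regular, choose `v₀` adjacent to a vertex of larger degree and give all its edges the sign
`1`; if `G` is regular, one edge at `v₀` gets the sign `0` and the others `1`. In the regular case
there are fewer new neighbours to be split, and the invariant holds with `δ - 1 - a`; the two cases
are treated together by a parameter `ε`, which is `0` or `1`. The condition `DeficitBound` makes
sure that all other vertices have smaller weight, relative to their degree, than the root.
Processing class after class exhausts the connected graph by Zorn's lemma.

For `δ ≤ 2` a vertex other than the root has at most three children in a breadth first search tree,
so the children of a vertex can get distinct colours; the root is recognized as the only vertex of
degree `δ` without an edge of sign `-1`.
-/

namespace SimpleGraph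
namespace AsymmetricColoring

/-! ### Sign patterns with prescribed sums -/

section Signs
open Classical

variable {V β : Type*}

theorem exists_signs_card (S : Finset V) (p n : ℕ) (h : p + n ≤ S.card) :
    ∃ col : V → SignType, (S.filter fun v => col v = 1).card = p ∧
      (S.filter fun v => col v = -1).card = n ∧
      (S.filter fun v => col v = 0).card = S.card - p - n ∧
      ∑ v ∈ S, (col v : ℤ) = p - n := by
  obtain ⟨P, hPS, hP⟩ := Finset.exists_subset_card_eq (show p ≤ S.card by omega)
  have hSP : (S \ P).card = S.card - p := by rw [Finset.card_sdiff_of_subset hPS, hP]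
  obtain ⟨Q, hQS, hQ⟩ := Finset.exists_subset_card_eq (show n ≤ (S \ P).card by omega)
  have hQP : ∀ v ∈ Q, v ∈ S ∧ v ∉ P := fun v hv => Finset.mem_sdiff.1 (hQS hv)
  have h1 : (S.filter fun v => (if v ∈ P then (1 : SignType) else if v ∈ Q then -1 else 0) = 1)
      = P := by
    ext v
    by_cases hp : v ∈ P
    · simp [hp, hPS hp]
    · by_cases hq : v ∈ Q <;> simp [hp, hq]
  have h2 : (S.filter fun v => (if v ∈ P then (1 : SignType) else if v ∈ Q then -1 else 0) = -1)
      = Q := by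
    ext v
    by_cases hq : v ∈ Q
    · simp [(hQP v hq).2, (hQP v hq).1, hq]
    · by_cases hp : v ∈ P <;> simp [hp, hq]
  have h3 : (S.filter fun v => (if v ∈ P then (1 : SignType) else if v ∈ Q then -1 else 0) = 0)
      = (S \ P) \ Q := by
    ext v
    by_cases hp : v ∈ P
    · simp [hp]
    · by_cases hq : v ∈ Q <;> simp [hp, hq]
  refine ⟨fun v => if v ∈ P then 1 else if v ∈ Q then -1 else 0, ?_, ?_, ?_, ?_⟩
  · rw [h1, hP]
  · rw [h2, hQ]
  · rw [h3, Finset.card_sdiff_of_subset hQS, hSP, hQ]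
  · have key : ∀ v ∈ S, (((if v ∈ P then (1 : SignType) else if v ∈ Q then -1 else 0) : SignType) : ℤ)
        = (if v ∈ P then 1 else 0) - (if v ∈ Q then 1 else 0) := by
      intro v _
      by_cases hp : v ∈ P
      · have : v ∉ Q := fun hq => (hQP v hq).2 hp
        simp [hp, this]
      · by_cases hq : v ∈ Q <;> simp [hp, hq]
    have hPf : S ∩ P = P := Finset.inter_eq_right.2 hPS
    have hQf : S ∩ Q = Q := Finset.inter_eq_right.2 fun v hv => (hQP v hv).1
    rw [Finset.sum_congr rfl key, Finset.sum_sub_distrib]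
    simp [hPf, hQf, hP, hQ]

theorem exists_signs_block (Z : Finset V) (hZ : Z.Nonempty) (y : ℤ)
    (hy : 2 * |y| ≤ Z.card + 1) :
    ∃ col : V → SignType, ∑ v ∈ Z, (col v : ℤ) = y ∧
      ∀ t, (Z.filter fun v => col v = t).card ≤ max 1 (Z.card - 1) := by
  have hc : 1 ≤ Z.card := hZ.card_pos
  -- a zero sum on at least two elements needs one element of each sign to avoid being constant
  obtain ⟨p, n, hpn, hpy, hb⟩ : ∃ p n : ℕ, p + n ≤ Z.card ∧ (p : ℤ) - n = y ∧
      (Z.card = 1 ∨ (p ≤ Z.card - 1 ∧ n ≤ Z.card - 1 ∧ 1 ≤ p + n)) := by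
    rcases lt_trichotomy y 0 with h | h | h
    · rw [abs_of_neg h] at hy
      exact ⟨0, (-y).toNat, by omega, by omega, by omega⟩
    · by_cases h1 : Z.card = 1
      · exact ⟨0, 0, by omega, by omega, by omega⟩
      · exact ⟨1, 1, by omega, by omega, by omega⟩
    · rw [abs_of_pos h] at hy
      exact ⟨y.toNat, 0, by omega, by omega, by omega⟩
  obtain ⟨col, h1, h2, h3, h4⟩ := exists_signs_card Z p n hpn
  refine ⟨col, by rw [h4, hpy], fun t => ?_⟩
  rcases hb with hb | hb
  · exact le_max_of_le_left (hb ▸ Finset.card_filter_le _ _)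
  · refine le_max_of_le_right ?_
    cases t
    · change (Z.filter fun v => col v = 0).card ≤ _
      omega
    · change (Z.filter fun v => col v = -1).card ≤ _
      omega
    · change (Z.filter fun v => col v = 1).card ≤ _
      omega

/-- Every small sum is attained by a sign pattern that is constant on no class of size at least
two; classes of size one contribute arbitrary signs. -/
theorem exists_signs_classes (κ : V → β) (A : Finset V) (y : ℤ) (hy : 2 * |y| ≤ A.card + 1) :
    ∃ col : V → SignType, ∑ v ∈ A, (col v : ℤ) = y ∧
      ∀ k t, (A.filter fun v => κ v = k ∧ col v = t).card ≤
        max 1 ((A.filter fun v => κ v = k).card - 1) := by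
  induction A using Finset.strongInduction generalizing y with
  | H A ih =>
    rcases A.eq_empty_or_nonempty with rfl | ⟨a, ha⟩
    · have : y = 0 := by
        have := abs_nonneg y
        simp only [Finset.card_empty, Nat.cast_zero, zero_add] at hy
        exact abs_eq_zero.1 (by omega)
      exact ⟨fun _ => 0, by simp [this], by simp⟩
    · set Z := A.filter fun v => κ v = κ a with hZ
      set B := A.filter fun v => ¬ κ v = κ a with hB
      have haZ : a ∈ Z := by simp [hZ, ha]
      have hcard : Z.card + B.card = A.card := Finset.card_filter_add_card_filter_not _
      have hZ1 : 1 ≤ Z.card := Finset.card_pos.2 ⟨a, haZ⟩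
      have hBA : B ⊂ A := by
        refine Finset.ssubset_iff_subset_ne.2 ⟨Finset.filter_subset _ _, fun h => ?_⟩
        rw [h] at hcard
        omega
      obtain ⟨y₁, y₂, hyy, hy₁, hy₂⟩ : ∃ y₁ y₂ : ℤ, y₁ + y₂ = y ∧ 2 * |y₁| ≤ Z.card + 1 ∧
          2 * |y₂| ≤ B.card + 1 := by
        set z : ℤ := (((Z.card + 1) / 2 : ℕ) : ℤ) with hz
        refine ⟨max (-z) (min y z), y - max (-z) (min y z), by ring, ?_, ?_⟩ <;>
        rcases abs_cases y with h | h <;>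
        rcases max_cases (-z) (min y z) with h' | h' <;>
        rcases min_cases y z with h'' | h''
        all_goals
          first
          | (rcases abs_cases (max (-z) (min y z)) with h3 | h3 <;>
             rcases abs_cases (y - max (-z) (min y z)) with h4 | h4 <;> omega)
      obtain ⟨c₁, hc₁, hb₁⟩ := exists_signs_block Z ⟨a, haZ⟩ y₁ hy₁
      obtain ⟨c₂, hc₂, hb₂⟩ := ih B hBA y₂ hy₂
      refine ⟨fun v => if κ v = κ a then c₁ v else c₂ v, ?_, fun k t => ?_⟩
      · rw [← Finset.sum_filter_add_sum_filter_not A (fun v => κ v = κ a), ← hyy, ← hc₁, ← hc₂]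
        congr 1
        · exact Finset.sum_congr rfl fun v hv => by simp [(Finset.mem_filter.1 hv).2]
        · exact Finset.sum_congr rfl fun v hv => by simp [(Finset.mem_filter.1 hv).2]
      · by_cases hk : k = κ a
        · subst hk
          convert hb₁ t using 2
          ext v
          simp only [hZ, Finset.mem_filter]
          constructor
          · rintro ⟨h1, h2, h3⟩
            exact ⟨⟨h1, h2⟩, by simpa [h2] using h3⟩
          · rintro ⟨⟨h1, h2⟩, h3⟩
            exact ⟨h1, h2, by simpa [h2] using h3⟩
        · have e1 : (A.filter fun v => κ v = k ∧ (if κ v = κ a then c₁ v else c₂ v) = t) =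
              B.filter fun v => κ v = k ∧ c₂ v = t := by
            ext v
            simp only [hB, Finset.mem_filter]
            constructor
            · rintro ⟨h1, rfl, h3⟩
              exact ⟨⟨h1, hk⟩, rfl, by simpa [hk] using h3⟩
            · rintro ⟨⟨h1, h2⟩, rfl, h3⟩
              exact ⟨h1, rfl, by simpa [h2] using h3⟩
          have e2 : (A.filter fun v => κ v = k) = B.filter fun v => κ v = k := by
            ext v
            simp only [hB, Finset.mem_filter]
            constructor
            · rintro ⟨h1, rfl⟩
              exact ⟨⟨h1, hk⟩, rfl⟩
            · rintro ⟨⟨h1, -⟩, h3⟩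
              exact ⟨h1, h3⟩
          rw [e1, e2]
          exact hb₂ k t

/-- If three colours are to split a set into parts of size at most `q`, all sums of absolute value
less than `q` can still be attained. -/
theorem exists_signs_capped (F : Finset V) (q : ℕ) (hF : F.card ≤ 2 * q + 1)
    (hqF : q + 2 ≤ F.card) (y : ℤ) (hy : |y| + 1 ≤ q) :
    ∃ col : V → SignType, ∑ v ∈ F, (col v : ℤ) = y ∧
      ∀ t, (F.filter fun v => col v = t).card ≤ q := by
  obtain ⟨p, n, hpn, hpy, hp, hn, hz⟩ : ∃ p n : ℕ, p + n ≤ F.card ∧ (p : ℤ) - n = y ∧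
      p ≤ q ∧ n ≤ q ∧ F.card - p - n ≤ q := by
    rcases abs_cases y with ⟨h, h0⟩ | ⟨h, h0⟩
    · refine ⟨y.toNat + (F.card - y.toNat - q + 1) / 2, (F.card - y.toNat - q + 1) / 2, ?_, ?_, ?_,
        ?_, ?_⟩ <;> omega
    · refine ⟨(F.card - (-y).toNat - q + 1) / 2, (-y).toNat + (F.card - (-y).toNat - q + 1) / 2,
        ?_, ?_, ?_, ?_, ?_⟩ <;> omega
  obtain ⟨col, h1, h2, h3, h4⟩ := exists_signs_card F p n hpn
  refine ⟨col, by rw [h4, hpy], fun t => ?_⟩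
  cases t
  · change (F.filter fun v => col v = 0).card ≤ _
    omega
  · change (F.filter fun v => col v = -1).card ≤ _
    omega
  · change (F.filter fun v => col v = 1).card ≤ _
    omega

theorem exists_signs_nonpos (D : Finset V) (n : ℕ) (hn : n ≤ D.card) :
    ∃ col : V → SignType, ∑ v ∈ D, (col v : ℤ) = -n ∧ ∀ v ∈ D, col v ≠ 1 := by
  obtain ⟨col, h1, -, -, h4⟩ := exists_signs_card D 0 n (by omega)
  refine ⟨col, by simpa using h4, fun v hv hv1 => ?_⟩
  have : v ∈ D.filter fun v => col v = 1 := by simp [hv, hv1]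
  rw [Finset.card_eq_zero.1 h1] at this
  simp at this

/-- The flexibility of the edges from one vertex to a set `N` of unprocessed vertices. Here `F`
stands for the vertices of `N` without processed neighbours and `D` for those that must not
receive the sign `1`. There is an interval `[K - E, K]` of attainable sums which depends only on
`N`, `D`, `F` and not on the partition of the remaining vertices into classes of `κ`. -/
theorem exists_flexible_sum (N D F : Finset V) (hD : D ⊆ N) (hF : F ⊆ N) (hDF : Disjoint D F)
    (q E : ℕ) (hE : E ≤ N.card)
    (hq : F.card ≤ q + 1 ∨ (F.card ≤ 2 * q + 1 ∧ E ≤ q ∧ 2 ≤ q)) :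
    ∃ K : ℤ, (1 ≤ N.card → K + 1 ≤ E) ∧ (N.card = 0 → K = 0) ∧
      ∀ (κ : V → Set V) (e : ℕ), e ≤ E → ∃ col : V → SignType,
        ∑ v ∈ N, (col v : ℤ) = K - e ∧ (∀ v ∈ D, col v ≠ 1) ∧
        (∀ t, (F.filter fun v => col v = t).card ≤ max 1 q) ∧
        ∀ k t, (((N \ D) \ F).filter fun v => κ v = k ∧ col v = t).card ≤
          max 1 ((((N \ D) \ F).filter fun v => κ v = k).card - 1) := by
  have hFD : F ⊆ N \ D := fun v hv =>
    Finset.mem_sdiff.2 ⟨hF hv, fun h => Finset.disjoint_left.1 hDF h hv⟩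
  have hcD : (N \ D).card + D.card = N.card := Finset.card_sdiff_add_card_eq_card hD
  have hcF : ((N \ D) \ F).card + F.card = (N \ D).card := Finset.card_sdiff_add_card_eq_card hFD
  by_cases hsmall : F.card ≤ q + 1
  · refine ⟨E - D.card - (((N \ D).card + 1) / 2 : ℕ), fun h => by omega, fun h => by omega, ?_⟩
    intro κ e he
    -- let `D` absorb the part of the sum that the other vertices cannot reach
    obtain ⟨n, y, hn, hy, hyn⟩ : ∃ (n : ℕ) (y : ℤ), n ≤ D.card ∧ 2 * |y| ≤ (N \ D).card + 1 ∧
        y - n = (E - D.card - (((N \ D).card + 1) / 2 : ℕ) : ℤ) - e := by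
      by_cases h : E - e ≤ D.card
      · refine ⟨D.card - (E - e), -(((N \ D).card + 1) / 2 : ℕ), by omega, ?_, by omega⟩
        rw [abs_neg, abs_of_nonneg (by omega)]
        omega
      · refine ⟨0, E - e - D.card - (((N \ D).card + 1) / 2 : ℕ), by omega, ?_, by omega⟩
        rcases abs_cases ((E : ℤ) - e - D.card - (((N \ D).card + 1) / 2 : ℕ)) with h | h <;> omega
    obtain ⟨c₁, h₁, hc₁⟩ := exists_signs_nonpos D n hn
    -- treat `F` as one further class
    obtain ⟨κ', hκF, hκ⟩ : ∃ κ' : V → Set (Option V), (∀ v ∈ F, κ' v = {none}) ∧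
        ∀ v, v ∉ F → κ' v = some '' κ v :=
      ⟨fun v => if v ∈ F then {none} else some '' κ v, fun v hv => by simp [hv],
        fun v hv => by simp [hv]⟩
    have hne : ∀ s : Set V, some '' s ≠ {none} := fun s h => by
      have : none ∈ some '' s := h ▸ Set.mem_singleton none
      simp at this
    have hinj : ∀ s t : Set V, some '' s = some '' t ↔ s = t := fun s t =>
      (Option.some_injective V).image_injective.eq_iff
    obtain ⟨c₂, h₂, hc₂⟩ := exists_signs_classes κ' (N \ D) y hy
    refine ⟨fun v => if v ∈ D then c₁ v else c₂ v, ?_, fun v hv => by simpa [hv] using hc₁ v hv,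
      fun t => ?_, fun k t => ?_⟩
    · rw [← hyn, ← Finset.sum_sdiff hD, sub_eq_add_neg, ← h₁, ← h₂]
      congr 1
      · exact Finset.sum_congr rfl fun v hv => by simp [(Finset.mem_sdiff.1 hv).2]
      · exact Finset.sum_congr rfl fun v hv => by simp [hv]
    · have : ((N \ D).filter fun v => κ' v = {none} ∧ c₂ v = t).card ≤
          max 1 (((N \ D).filter fun v => κ' v = {none}).card - 1) := by
        convert hc₂ {none} t
      have e1 : ((N \ D).filter fun v => κ' v = {none}) = F := by
        ext v
        by_cases hv : v ∈ F
        · simpa [hκF v hv, hv] using Finset.mem_sdiff.1 (hFD hv)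
        · simp [hκ v hv, hv, hne]
      have e2 : ((N \ D).filter fun v => κ' v = {none} ∧ c₂ v = t)
          = F.filter fun v => (if v ∈ D then c₁ v else c₂ v) = t := by
        rw [← Finset.filter_filter, e1]
        exact Finset.filter_congr fun v hv => by simp [(Finset.mem_sdiff.1 (hFD hv)).2]
      rw [e1, e2] at this
      refine this.trans ?_
      omega
    · have : ((N \ D).filter fun v => κ' v = some '' k ∧ c₂ v = t).card ≤
          max 1 (((N \ D).filter fun v => κ' v = some '' k).card - 1) := by
        convert hc₂ (some '' k) t
      have e1 : ((N \ D).filter fun v => κ' v = some '' k) =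
          ((N \ D) \ F).filter fun v => κ v = k := by
        ext v
        by_cases hv : v ∈ F
        · simp [hκF v hv, hv, (hne k).symm]
        · simp [hκ v hv, hv, hinj]
      have e2 : ((N \ D).filter fun v => κ' v = some '' k ∧ c₂ v = t)
          = ((N \ D) \ F).filter fun v => κ v = k ∧ (if v ∈ D then c₁ v else c₂ v) = t := by
        ext v
        by_cases hv : v ∈ F
        · simp [hκF v hv, hv, (hne k).symm]
        · by_cases hd : v ∈ D <;> simp [hκ v hv, hv, hd, hinj]
      rwa [e1, e2] at this
  · -- the many vertices of `F` provide the required sums on their own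
    obtain ⟨hF1, hEq, hq2⟩ := hq.resolve_left hsmall
    refine ⟨E - (q - 1 : ℕ), fun h => by omega, fun h => by omega, ?_⟩
    intro κ e he
    obtain ⟨c₁, h₁, hc₁⟩ := exists_signs_capped F q hF1 (by omega) (E - (q - 1 : ℕ) - e) (by
      rcases abs_cases ((E : ℤ) - (q - 1 : ℕ) - e) with h | h <;> omega)
    obtain ⟨c₂, h₂, hc₂⟩ := exists_signs_classes κ ((N \ D) \ F) 0 (by rw [abs_zero]; omega)
    refine ⟨fun v => if v ∈ D then 0 else if v ∈ F then c₁ v else c₂ v, ?_,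
      fun v hv => by simp [hv], fun t => ?_, fun k t => ?_⟩
    · rw [← Finset.sum_sdiff hD, ← Finset.sum_sdiff hFD, ← h₁]
      have a1 : ∑ v ∈ D, ((if v ∈ D then 0 else if v ∈ F then c₁ v else c₂ v : SignType) : ℤ)
          = 0 := Finset.sum_eq_zero fun v hv => by simp [hv]
      have a2 : ∑ v ∈ F, ((if v ∈ D then 0 else if v ∈ F then c₁ v else c₂ v : SignType) : ℤ)
          = ∑ v ∈ F, (c₁ v : ℤ) :=
        Finset.sum_congr rfl fun v hv => by simp [(Finset.mem_sdiff.1 (hFD hv)).2, hv]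
      have a3 : ∑ v ∈ (N \ D) \ F,
          ((if v ∈ D then 0 else if v ∈ F then c₁ v else c₂ v : SignType) : ℤ)
          = ∑ v ∈ (N \ D) \ F, (c₂ v : ℤ) := Finset.sum_congr rfl fun v hv => by
        simp only [Finset.mem_sdiff] at hv
        simp [hv.1.2, hv.2]
      rw [a1, a2, a3, h₂]
      ring
    · refine le_max_of_le_right (le_of_eq_of_le ?_ (hc₁ t))
      congr 1
      exact Finset.filter_congr fun v hv => by simp [(Finset.mem_sdiff.1 (hFD hv)).2, hv]
    · refine le_of_eq_of_le ?_ (hc₂ k t)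
      congr 1
      refine Finset.filter_congr fun v hv => ?_
      simp only [Finset.mem_sdiff] at hv
      simp [hv.1.2, hv.2]

end Signs

/-! ### Partial colourings -/

section Partial
open Classical

variable {V : Type*} (G : SimpleGraph V) [G.LocallyFinite]

/-- The finite set of neighbours of `v` that lie in `S`. -/
noncomputable def nbrsIn (S : Set V) (v : V) : Finset V :=
  (G.neighborFinset v).filter (· ∈ S)

/-- Two vertices are similar with respect to `S` if they have the same degree and are joined to
the vertices of `S` in the same way, colours included. -/
def Similar (w : V → V → SignType) (S : Set V) (v v' : V) : Prop :=
  G.degree v = G.degree v' ∧ ∀ x ∈ S, (G.Adj x v ↔ G.Adj x v') ∧ (G.Adj x v → w x v = w x v')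

/-- A set of pairwise similar vertices of `W` that have `a ≥ 1` neighbours in `S` has at most
`max 1 (δ - ε - a)` elements. -/
def ClassBound (δ ε : ℕ) (w : V → V → SignType) (S W : Set V) : Prop :=
  ∀ v ∈ W, (nbrsIn G S v).Nonempty → ∀ T : Finset V, (∀ t ∈ T, t ∈ W ∧ Similar G w S v t) →
    T.card ≤ max 1 (δ - ε - (nbrsIn G S v).card)

/-- The deficit of `v` on its edges to `S`: an edge of sign `s` contributes `1 - s`. -/
noncomputable def deficit (w : V → V → SignType) (S : Set V) (v : V) : ℤ :=
  ∑ x ∈ nbrsIn G S v, (1 - (w x v : ℤ))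

/-- If only `r ≤ ε` of the neighbours of a vertex of `W` lie outside `S`, then its deficit on `S`
is at least `1 + ε - r`. -/
def DeficitBound (ε : ℕ) (w : V → V → SignType) (S W : Set V) : Prop :=
  ∀ v ∈ W, G.degree v ≤ (nbrsIn G S v).card + ε →
    (1 + ε + (nbrsIn G S v).card - G.degree v : ℤ) ≤ deficit G w S v

variable {G}

theorem mem_nbrsIn {S : Set V} {v x : V} : x ∈ nbrsIn G S v ↔ G.Adj v x ∧ x ∈ S := by
  simp [nbrsIn]

theorem nbrsIn_insert_of_adj {S : Set V} {u v : V} (h : G.Adj u v) :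
    nbrsIn G (insert u S) v = insert u (nbrsIn G S v) := by
  ext x
  simp only [mem_nbrsIn, Finset.mem_insert, Set.mem_insert_iff]
  constructor
  · rintro ⟨h1, rfl | h2⟩
    · exact Or.inl rfl
    · exact Or.inr ⟨h1, h2⟩
  · rintro (rfl | h1)
    · exact ⟨h.symm, Or.inl rfl⟩
    · exact ⟨h1.1, Or.inr h1.2⟩

theorem nbrsIn_insert_of_not_adj {S : Set V} {u v : V} (h : ¬ G.Adj u v) :
    nbrsIn G (insert u S) v = nbrsIn G S v := by
  ext x
  simp only [mem_nbrsIn, Set.mem_insert_iff]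
  constructor
  · rintro ⟨h1, rfl | h2⟩
    · exact absurd h1.symm h
    · exact ⟨h1, h2⟩
  · rintro ⟨h1, h2⟩
    exact ⟨h1, Or.inr h2⟩

namespace Similar

variable {w : V → V → SignType} {S S' : Set V} {v v' v'' : V}

theorem refl (w : V → V → SignType) (S : Set V) (v : V) : Similar G w S v v :=
  ⟨rfl, fun _ _ => ⟨Iff.rfl, fun _ => rfl⟩⟩

theorem symm (h : Similar G w S v v') : Similar G w S v' v :=
  ⟨h.1.symm, fun x hx => ⟨(h.2 x hx).1.symm, fun ha => ((h.2 x hx).2 ((h.2 x hx).1.2 ha)).symm⟩⟩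

theorem trans (h : Similar G w S v v') (h' : Similar G w S v' v'') : Similar G w S v v'' :=
  ⟨h.1.trans h'.1, fun x hx => ⟨(h.2 x hx).1.trans (h'.2 x hx).1,
    fun ha => ((h.2 x hx).2 ha).trans ((h'.2 x hx).2 ((h.2 x hx).1.1 ha))⟩⟩

theorem mono (h : Similar G w S v v') (hS : S' ⊆ S) : Similar G w S' v v' :=
  ⟨h.1, fun x hx => h.2 x (hS hx)⟩

theorem congr {w' : V → V → SignType} (h : Similar G w S v v')
    (hv : ∀ x ∈ S, w x v = w' x v) (hv' : ∀ x ∈ S, w x v' = w' x v') :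
    Similar G w' S v v' :=
  ⟨h.1, fun x hx => ⟨(h.2 x hx).1, fun ha => by
    rw [← hv x hx, ← hv' x hx]
    exact (h.2 x hx).2 ha⟩⟩

theorem nbrsIn_eq (h : Similar G w S v v') : nbrsIn G S v = nbrsIn G S v' := by
  ext x
  simp only [mem_nbrsIn]
  constructor
  · rintro ⟨h1, h2⟩
    exact ⟨((h.2 x h2).1.1 h1.symm).symm, h2⟩
  · rintro ⟨h1, h2⟩
    exact ⟨((h.2 x h2).1.2 h1.symm).symm, h2⟩

end Similar

theorem ClassBound.congr {δ ε : ℕ} {w w' : V → V → SignType} {S W : Set V}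
    (h : ClassBound G δ ε w S W) (hw : ∀ x ∈ S, ∀ v ∈ W, w x v = w' x v) :
    ClassBound G δ ε w' S W := fun v hv hn T hT =>
  h v hv hn T fun t ht => ⟨(hT t ht).1, (hT t ht).2.congr (fun x hx => (hw x hx v hv).symm)
    fun x hx => (hw x hx t (hT t ht).1).symm⟩

theorem deficit_congr {w w' : V → V → SignType} {S : Set V} {v : V}
    (hw : ∀ x ∈ S, w x v = w' x v) : deficit G w S v = deficit G w' S v :=
  Finset.sum_congr rfl fun x hx => by rw [hw x (mem_nbrsIn.1 hx).2]

theorem DeficitBound.congr {ε : ℕ} {w w' : V → V → SignType} {S W : Set V}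
    (h : DeficitBound G ε w S W) (hw : ∀ x ∈ S, ∀ v ∈ W, w x v = w' x v) :
    DeficitBound G ε w' S W := fun v hv hd => by
  rw [← deficit_congr fun x hx => hw x hx v hv]
  exact h v hv hd

/-- Recolour the edges from `u` to `W` by `col`. -/
noncomputable def paint (w : V → V → SignType) (u : V) (W : Set V) (col : V → SignType) :
    V → V → SignType := fun x y =>
  if x = u ∧ y ∈ W then col y else if y = u ∧ x ∈ W then col x else w x y

theorem paint_left (w : V → V → SignType) {u : V} {W : Set V} (col : V → SignType) {y : V}
    (hy : y ∈ W) : paint w u W col u y = col y := by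
  simp [paint, hy]

theorem paint_of_ne (w : V → V → SignType) {u : V} {W : Set V} (col : V → SignType) {x y : V}
    (h : ¬ (x = u ∧ y ∈ W)) (h' : ¬ (y = u ∧ x ∈ W)) : paint w u W col x y = w x y := by
  simp only [paint]
  rw [if_neg h, if_neg h']

theorem paint_symm {w : V → V → SignType} (hw : ∀ x y, w x y = w y x) {u : V} {W : Set V}
    (hu : u ∉ W) (col : V → SignType) (x y : V) :
    paint w u W col x y = paint w u W col y x := by
  unfold paint
  by_cases h1 : x = u ∧ y ∈ W
  · simp only [h1, and_self, if_true]
    rw [if_neg]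
    exact fun h => hu h.2
  · rw [if_neg h1]
    by_cases h2 : y = u ∧ x ∈ W
    · rw [if_pos h2, if_pos h2]
    · rw [if_neg h2, if_neg h2, if_neg h1, hw]

/-- The conditions on the colours `col` of the edges from a vertex `u` to the set `W` of
unprocessed vertices that allow to add `u` to the set `S` of processed vertices. -/
structure Admissible (G : SimpleGraph V) [G.LocallyFinite] (δ ε : ℕ) (w : V → V → SignType)
    (S W : Set V) (u : V) (col : V → SignType) : Prop where
  ne_one : ∀ v ∈ nbrsIn G W u, G.degree v ≤ (nbrsIn G S v).card + 1 + ε → col v ≠ 1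
  fresh : ∀ t, ((nbrsIn G W u).filter fun v => nbrsIn G S v = ∅ ∧ col v = t).card ≤
    max 1 (δ - ε - 1)
  classes : ∀ v ∈ nbrsIn G W u, (nbrsIn G S v).Nonempty → ∀ t,
    ((nbrsIn G W u).filter fun x => Similar G w S v x ∧ col x = t).card ≤
      max 1 (((nbrsIn G W u).filter fun x => Similar G w S v x).card - 1)

section Step

variable {δ ε : ℕ} {w : V → V → SignType} {S W : Set V} {u : V} {col : V → SignType}

theorem Admissible.classBound (hcol : Admissible G δ ε w S W u col) (huS : u ∉ S) (huW : u ∉ W)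
    (hC : ClassBound G δ ε w S W) :
    ClassBound G δ ε (paint w u W col) (insert u S) W := by
  have hold : ∀ x ∈ S, ∀ v ∈ W, paint w u W col x v = w x v := fun x hx v hv =>
    paint_of_ne w col (fun h => huS (h.1 ▸ hx)) fun h => huW (h.1 ▸ hv)
  have hsim : ∀ v ∈ W, ∀ t ∈ W, Similar G (paint w u W col) (insert u S) v t →
      Similar G w S v t := fun v hv t ht h =>
    (h.mono (Set.subset_insert u S)).congr (fun x hx => hold x hx v hv)
      fun x hx => hold x hx t ht
  intro v hv hne T hT
  by_cases huv : G.Adj u v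
  · have hcard : (nbrsIn G (insert u S) v).card = (nbrsIn G S v).card + 1 := by
      rw [nbrsIn_insert_of_adj huv, Finset.card_insert_of_notMem fun h => huS (mem_nbrsIn.1 h).2]
    have hTu : ∀ t ∈ T, t ∈ nbrsIn G W u ∧ Similar G w S v t ∧ col t = col v := by
      intro t ht
      have hadj := ((hT t ht).2.2 u (Set.mem_insert u S)).1.1 huv
      have hc := ((hT t ht).2.2 u (Set.mem_insert u S)).2 huv
      rw [paint_left w col hv, paint_left w col (hT t ht).1] at hc
      exact ⟨mem_nbrsIn.2 ⟨hadj, (hT t ht).1⟩, hsim v hv t (hT t ht).1 (hT t ht).2, hc.symm⟩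
    have hvN : v ∈ nbrsIn G W u := mem_nbrsIn.2 ⟨huv, hv⟩
    rw [hcard]
    rcases (nbrsIn G S v).eq_empty_or_nonempty with h0 | h0
    · refine (Finset.card_le_card fun t ht => ?_).trans ((hcol.fresh (col v)).trans (by
        rw [h0, Finset.card_empty]))
      obtain ⟨h1, h2, h3⟩ := hTu t ht
      exact Finset.mem_filter.2 ⟨h1, h2.nbrsIn_eq ▸ h0, h3⟩
    · have h1 : T.card ≤ _ := (Finset.card_le_card fun t ht => by
        obtain ⟨h1, h2, h3⟩ := hTu t ht
        exact Finset.mem_filter.2 ⟨h1, h2, h3⟩).trans (hcol.classes v hvN h0 (col v))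
      have h2 := hC v hv h0 ((nbrsIn G W u).filter fun x => Similar G w S v x) fun t ht =>
        ⟨(mem_nbrsIn.1 (Finset.mem_filter.1 ht).1).2, (Finset.mem_filter.1 ht).2⟩
      omega
  · rw [nbrsIn_insert_of_not_adj huv] at hne ⊢
    exact hC v hv hne T fun t ht => ⟨(hT t ht).1, hsim v hv t (hT t ht).1 (hT t ht).2⟩

theorem Admissible.deficitBound (hcol : Admissible G δ ε w S W u col) (huS : u ∉ S) (huW : u ∉ W)
    (hD : DeficitBound G ε w S W) :
    DeficitBound G ε (paint w u W col) (insert u S) W := by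
  intro v hv hdeg
  have hold : deficit G (paint w u W col) S v = deficit G w S v := deficit_congr fun x hx =>
    paint_of_ne w col (fun h => huS (h.1 ▸ hx)) fun h => huW (h.1 ▸ hv)
  by_cases huv : G.Adj u v
  · have hu : u ∉ nbrsIn G S v := fun h => huS (mem_nbrsIn.1 h).2
    have hcard : (nbrsIn G (insert u S) v).card = (nbrsIn G S v).card + 1 := by
      rw [nbrsIn_insert_of_adj huv, Finset.card_insert_of_notMem hu]
    have hdef : deficit G (paint w u W col) (insert u S) v =
        (1 - (col v : ℤ)) + deficit G w S v := by
      rw [← hold, deficit, nbrsIn_insert_of_adj huv, Finset.sum_insert hu, paint_left w col hv]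
      rfl
    rw [hcard] at hdeg
    have hc := hcol.ne_one v (mem_nbrsIn.2 ⟨huv, hv⟩) (by omega)
    have hc' : (1 : ℤ) ≤ 1 - (col v : ℤ) := by
      revert hc
      cases col v <;> decide
    rw [hcard, hdef]
    push_cast
    by_cases h : G.degree v ≤ (nbrsIn G S v).card + ε
    · have := hD v hv h
      omega
    · have : 0 ≤ deficit G w S v := Finset.sum_nonneg fun x _ => by
        cases w x v <;> decide
      omega
  · rw [nbrsIn_insert_of_not_adj huv] at hdeg ⊢
    have h1 : deficit G (paint w u W col) (insert u S) v = deficit G w S v := by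
      rw [← hold, deficit, nbrsIn_insert_of_not_adj huv]
      rfl
    rw [h1]
    exact hD v hv hdeg

/-- The sums of the signs on the edges from `u` to `W` that admissible colourings attain include
an interval `[K - E, K]` that does not depend on the colours chosen so far. -/
theorem exists_admissible (hε : ε ≤ 1) (hδ : 3 ≤ δ) (hdeg : ∀ v, δ ≤ G.degree v)
    (S W : Set V) (u : V) (E : ℕ) (hE : E ≤ (nbrsIn G W u).card)
    (hq : (nbrsIn G W u).card ≤ δ - ε ∨ ((nbrsIn G W u).card ≤ 2 * (δ - ε - 1) + 1 ∧
      E ≤ δ - ε - 1 ∧ 2 ≤ δ - ε - 1)) :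
    ∃ K : ℤ, (1 ≤ (nbrsIn G W u).card → K + 1 ≤ E) ∧ ((nbrsIn G W u).card = 0 → K = 0) ∧
      ∀ w, ClassBound G δ ε w S W → ∀ e ≤ E, ∃ col, Admissible G δ ε w S W u col ∧
        ∑ x ∈ nbrsIn G W u, (col x : ℤ) = K - e := by
  set N := nbrsIn G W u with hN
  set D := N.filter fun v => G.degree v ≤ (nbrsIn G S v).card + 1 + ε with hD
  set F := N.filter fun v => nbrsIn G S v = ∅ with hF
  have hDF : Disjoint D F := by
    refine Finset.disjoint_left.2 fun v h1 h2 => ?_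
    have h1 := (Finset.mem_filter.1 h1).2
    rw [(Finset.mem_filter.1 h2).2, Finset.card_empty] at h1
    have := hdeg v
    omega
  have hFN : F.card ≤ N.card := Finset.card_filter_le _ _
  obtain ⟨K, hK1, hK0, hK⟩ := exists_flexible_sum N D F (Finset.filter_subset _ _)
    (Finset.filter_subset _ _) hDF (δ - ε - 1) E hE (by omega)
  refine ⟨K, hK1, hK0, fun w hC e he => ?_⟩
  obtain ⟨col, hsum, hcD, hcF, hcl⟩ := hK (fun v => {x | Similar G w S v x}) e he
  have hκ : ∀ v x, {y | Similar G w S x y} = {y | Similar G w S v y} ↔ Similar G w S v x := by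
    intro v x
    refine ⟨fun h => ?_, fun h => ?_⟩
    · have : x ∈ {y | Similar G w S x y} := Similar.refl w S x
      rw [h] at this
      exact this
    · ext y
      exact ⟨fun h' => h.trans h', fun h' => h.symm.trans h'⟩
  -- vertices in `D` are not similar to any other vertex of `N`
  have hone : ∀ v ∈ D, (N.filter fun x => Similar G w S v x).card ≤ 1 := by
    intro v hv
    have hvD := (Finset.mem_filter.1 hv).2
    have hne : (nbrsIn G S v).Nonempty := by
      rw [Finset.nonempty_iff_ne_empty]
      intro h
      exact Finset.disjoint_left.1 hDF hv (Finset.mem_filter.2 ⟨(Finset.mem_filter.1 hv).1, h⟩)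
    have := hC v (mem_nbrsIn.1 (Finset.mem_filter.1 hv).1).2 hne
      (N.filter fun x => Similar G w S v x) fun t ht =>
        ⟨(mem_nbrsIn.1 (Finset.mem_filter.1 ht).1).2, (Finset.mem_filter.1 ht).2⟩
    have := hdeg v
    omega
  refine ⟨col, ⟨fun v hv h => hcD v (Finset.mem_filter.2 ⟨hv, h⟩), fun t => ?_,
    fun v hv hne t => ?_⟩, hsum⟩
  · have := hcF t
    rwa [hF, Finset.filter_filter] at this
  · by_cases hvD : v ∈ D
    · refine le_max_of_le_left ((Finset.card_le_card fun x hx => ?_).trans (hone v hvD))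
      obtain ⟨h1, h2, -⟩ := Finset.mem_filter.1 hx
      exact Finset.mem_filter.2 ⟨h1, h2⟩
    · have hmem : ∀ x ∈ N, Similar G w S v x → x ∈ (N \ D) \ F := by
        intro x hx hs
        refine Finset.mem_sdiff.2 ⟨Finset.mem_sdiff.2 ⟨hx, fun hxD => hvD ?_⟩, fun hxF => ?_⟩
        · have h := Finset.card_le_one.1 (hone x hxD) v (Finset.mem_filter.2 ⟨hv, hs.symm⟩) x
            (Finset.mem_filter.2 ⟨hx, Similar.refl w S x⟩)
          exact h ▸ hxD
        · rw [hs.nbrsIn_eq, (Finset.mem_filter.1 hxF).2] at hne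
          simp at hne
      have e1 : (N.filter fun x => Similar G w S v x) = ((N \ D) \ F).filter fun x =>
          {y | Similar G w S x y} = {y | Similar G w S v y} := by
        ext x
        simp only [Finset.mem_filter, hκ]
        exact ⟨fun h => ⟨hmem x h.1 h.2, h.2⟩, fun h =>
          ⟨(Finset.mem_sdiff.1 (Finset.mem_sdiff.1 h.1).1).1, h.2⟩⟩
      have e2 : (N.filter fun x => Similar G w S v x ∧ col x = t) = ((N \ D) \ F).filter fun x =>
          {y | Similar G w S x y} = {y | Similar G w S v y} ∧ col x = t := by
        rw [← Finset.filter_filter, ← Finset.filter_filter, e1]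
      rw [e1, e2]
      convert hcl {y | Similar G w S v y} t

end Step

/-- The set of processed vertices after the first `k` vertices of the sequence `u` have been added
to `X`. -/
def stage {m : ℕ} (X : Set V) (u : Fin m → V) (k : ℕ) : Set V :=
  X ∪ {v | ∃ j : Fin m, j.val < k ∧ u j = v}

/-- Process the vertices of a sequence one after the other, prescribing the sum of the signs on
the edges from each of them to `W`. -/
theorem exists_paint_sequence {δ ε m : ℕ} {X W : Set V} (u : Fin m → V)
    (hu : Function.Injective u) (huX : ∀ k, u k ∉ X) (huW : ∀ k, u k ∉ W)
    (y : Fin m → ℤ)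
    (hflex : ∀ k : Fin m, ∀ w, ClassBound G δ ε w (stage X u k) W →
      ∃ col, Admissible G δ ε w (stage X u k) W (u k) col ∧
        ∑ x ∈ nbrsIn G W (u k), (col x : ℤ) = y k)
    (w : V → V → SignType) (hw : ∀ a b, w a b = w b a) (hC : ClassBound G δ ε w X W)
    (hD : DeficitBound G ε w X W) (k : ℕ) (hk : k ≤ m) :
    ∃ w' : V → V → SignType, (∀ a b, w' a b = w' b a) ∧
      (∀ a b, (a ∉ Set.range u ∨ b ∉ W) → (b ∉ Set.range u ∨ a ∉ W) → w' a b = w a b) ∧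
      ClassBound G δ ε w' (stage X u k) W ∧ DeficitBound G ε w' (stage X u k) W ∧
      ∀ j : Fin m, j.val < k → ∑ x ∈ nbrsIn G W (u j), (w' (u j) x : ℤ) = y j := by
  induction k with
  | zero =>
    have : stage X u 0 = X := by
      ext v
      simp [stage]
    rw [this]
    exact ⟨w, hw, fun _ _ _ _ => rfl, hC, hD, fun j hj => by omega⟩
  | succ k ih =>
    obtain ⟨w', hs, hag, hC', hD', hy⟩ := ih (by omega)
    set i : Fin m := ⟨k, hk⟩ with hi
    obtain ⟨col, hcol, hsum⟩ := hflex i w' hC'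
    have hst : stage X u (k + 1) = insert (u i) (stage X u k) := by
      ext v
      simp only [stage, Set.mem_union, Set.mem_ofPred_eq, Set.mem_insert_iff]
      constructor
      · rintro (h | ⟨j, hj, rfl⟩)
        · exact Or.inr (Or.inl h)
        · rcases Nat.lt_succ_iff_lt_or_eq.1 hj with h | h
          · exact Or.inr (Or.inr ⟨j, h, rfl⟩)
          · exact Or.inl (congrArg u (Fin.ext h))
      · rintro (rfl | h | ⟨j, hj, rfl⟩)
        · exact Or.inr ⟨i, Nat.lt_succ_self k, rfl⟩
        · exact Or.inl h
        · exact Or.inr ⟨j, by omega, rfl⟩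
    have hiS : u i ∉ stage X u k := by
      rintro (h | ⟨j, hj, h⟩)
      · exact huX i h
      · have := hu h
        rw [this] at hj
        exact lt_irrefl _ hj
    refine ⟨paint w' (u i) W col, paint_symm hs (huW i) col, fun a b h1 h2 => ?_, ?_, ?_,
      fun j hj => ?_⟩
    · rw [paint_of_ne, hag a b h1 h2]
      · rintro ⟨rfl, h⟩
        rcases h1 with h1 | h1
        · exact h1 ⟨i, rfl⟩
        · exact h1 h
      · rintro ⟨rfl, h⟩
        rcases h2 with h2 | h2
        · exact h2 ⟨i, rfl⟩
        · exact h2 h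
    · rw [hst]
      exact hcol.classBound hiS (huW i) hC'
    · rw [hst]
      exact hcol.deficitBound hiS (huW i) hD'
    · by_cases hji : j = i
      · rw [hji, ← hsum]
        exact Finset.sum_congr rfl fun x hx => by rw [paint_left w' col (mem_nbrsIn.1 hx).2]
      · have hlt : j.val < k := by
          rcases Nat.lt_succ_iff_lt_or_eq.1 hj with h | h
          · exact h
          · exact absurd (Fin.ext h) hji
        rw [← hy j hlt]
        refine Finset.sum_congr rfl fun x hx => ?_
        rw [paint_of_ne]
        · exact fun h => hji (hu h.1)
        · exact fun h => huW i (h.1 ▸ (mem_nbrsIn.1 hx).2)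

end Partial

/-! ### Fixing a class of similar vertices -/

section Run
open Classical

variable {V : Type*} {G : SimpleGraph V} [G.LocallyFinite]

/-- The sum of the signs of the edges at `v`. -/
noncomputable def weight (G : SimpleGraph V) [G.LocallyFinite] (w : V → V → SignType) (v : V) : ℤ :=
  ∑ x ∈ G.neighborFinset v, (w v x : ℤ)

theorem card_fin_le_add {m : ℕ} (i : Fin m) :
    (Finset.univ.filter fun j : Fin m => m ≤ i.val + j.val).card = i.val := by
  have h : (Finset.univ.filter fun j : Fin m => j.val < m - i.val).card = min m (m - i.val) :=
    Fin.card_filter_val_lt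
  have h2 := Finset.card_filter_add_card_filter_not (s := (Finset.univ : Finset (Fin m)))
    (fun j : Fin m => j.val < m - i.val)
  have h3 : (Finset.univ.filter fun j : Fin m => ¬ j.val < m - i.val) =
      Finset.univ.filter fun j : Fin m => m ≤ i.val + j.val := by
    refine Finset.filter_congr fun j _ => ?_
    have := i.isLt
    omega
  rw [h3, Finset.card_univ, Fintype.card_fin] at h2
  have := i.isLt
  omega

theorem sum_nbrsIn_eq {m : ℕ} (p : Fin m → V) (hp : Function.Injective p) (v : V) (f : V → ℤ) :
    ∑ x ∈ nbrsIn G (Set.range p) v, f x =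
      ∑ j ∈ Finset.univ.filter fun j => G.Adj v (p j), f (p j) := by
  rw [← Finset.sum_image (f := f) (g := p) fun a _ b _ h => hp h]
  refine Finset.sum_congr ?_ fun _ _ => rfl
  ext x
  simp only [mem_nbrsIn, Finset.mem_image, Finset.mem_filter, Finset.mem_univ, true_and]
  constructor
  · rintro ⟨h, j, rfl⟩
    exact ⟨j, h, rfl⟩
  · rintro ⟨j, h, rfl⟩
    exact ⟨h, j, rfl⟩

theorem sum_neighborFinset_split {X M W : Set V} (hXM : Disjoint X M) (hW : W = (X ∪ M)ᶜ) (v : V)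
    (f : V → ℤ) :
    ∑ x ∈ G.neighborFinset v, f x = ∑ x ∈ nbrsIn G X v, f x + ∑ x ∈ nbrsIn G M v, f x +
      ∑ x ∈ nbrsIn G W v, f x := by
  rw [← Finset.sum_union, ← Finset.sum_union]
  · refine Finset.sum_congr ?_ fun _ _ => rfl
    ext x
    simp only [Finset.mem_union, mem_nbrsIn, mem_neighborFinset, hW, Set.mem_compl_iff,
      Set.mem_union]
    tauto
  · refine Finset.disjoint_left.2 fun x h1 h2 => ?_
    simp only [Finset.mem_union, mem_nbrsIn, hW, Set.mem_compl_iff, Set.mem_union] at h1 h2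
    tauto
  · refine Finset.disjoint_left.2 fun x h1 h2 => ?_
    exact Set.disjoint_left.1 hXM (mem_nbrsIn.1 h1).2 (mem_nbrsIn.1 h2).2

/-- A class `M` of similar vertices can be processed in such a way that its members get pairwise
different weights. The edges inside `M` are coloured in the pattern of a threshold graph on the
labels `0, …, m - 1`: in the complete graph this gives the `i`-th vertex the sum `-i`, up to
errors `e i` caused by the non-edges and the missing loops, and these are compensated by the edges
leaving the class. -/
theorem exists_process_class {δ ε : ℕ} (hε : ε ≤ 1) (hδ : 3 ≤ δ) (hdeg : ∀ v, δ ≤ G.degree v)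
    (hdeg2 : ∀ v, G.degree v ≤ 2 * δ) (hreg : ε = 1 → ∀ v, G.degree v = δ)
    (X : Set V) (M : Finset V) (hXM : Disjoint X M) (w : V → V → SignType)
    (hw : ∀ a b, w a b = w b a) (hsim : ∀ v ∈ M, ∀ v' ∈ M, Similar G w X v v')
    (hne : ∀ v ∈ M, (nbrsIn G X v).Nonempty)
    (hsize : M.card ≤ 1 ∨ (M.card ≤ δ ∧ ∀ v ∈ M, M.card + (nbrsIn G X v).card ≤ G.degree v))
    (hC : ClassBound G δ ε w X (X ∪ M)ᶜ) (hD : DeficitBound G ε w X Xᶜ) :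
    ∃ w' : V → V → SignType, (∀ a b, w' a b = w' b a) ∧ (∀ a ∈ X, ∀ b, w' a b = w a b) ∧
      ClassBound G δ ε w' (X ∪ M) (X ∪ M)ᶜ ∧ DeficitBound G ε w' (X ∪ M) (X ∪ M)ᶜ ∧
      (∀ v ∈ M, weight G w' v + 1 + ε ≤ G.degree v) ∧
      ∀ v ∈ M, ∀ v' ∈ M, weight G w' v = weight G w' v' → v = v' := by
  set W : Set V := (X ∪ M)ᶜ with hW
  set m := M.card with hm
  obtain ⟨u, hu, huM⟩ : ∃ u : Fin m → V, Function.Injective u ∧ Set.range u = M := by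
    refine ⟨fun k => M.equivFin.symm k, fun a b h => by simpa using h, ?_⟩
    ext v
    constructor
    · rintro ⟨k, rfl⟩
      exact (M.equivFin.symm k).2
    · intro hv
      exact ⟨M.equivFin ⟨v, hv⟩, by simp⟩
  have huMem : ∀ k, u k ∈ M := fun k => by
    have : u k ∈ Set.range u := ⟨k, rfl⟩
    rwa [huM] at this
  have huX : ∀ k, u k ∉ X := fun k h => Set.disjoint_left.1 hXM h (huMem k)
  have huW : ∀ k, u k ∉ W := fun k h => h (Or.inr (huMem k))
  have hWX : ∀ v ∈ W, v ∉ X := fun v hv h => hv (Or.inl h)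
  have hWM : ∀ v ∈ W, v ∉ M := fun v hv h => hv (Or.inr h)
  -- degrees inside and outside of the class
  set l : V → ℕ := fun v => (nbrsIn G (M : Set V) v).card with hl
  set f : V → ℕ := fun v => (nbrsIn G W v).card with hf
  have hsplit : ∀ v, G.degree v = (nbrsIn G X v).card + l v + f v := by
    intro v
    have := sum_neighborFinset_split (G := G) hXM hW v fun _ => 1
    simp only [Finset.sum_const, nsmul_eq_mul, mul_one] at this
    have h2 : (G.degree v : ℤ) = (nbrsIn G X v).card + l v + f v := by
      rw [← card_neighborFinset_eq_degree, this]
    exact_mod_cast h2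
  have hlm : ∀ v ∈ M, l v + 1 ≤ m := by
    intro v hv
    have : nbrsIn G (M : Set V) v ⊆ M.erase v := fun x hx => by
      have hx := mem_nbrsIn.1 hx
      exact Finset.mem_erase.2 ⟨hx.1.ne', hx.2⟩
    have h : l v ≤ (M.erase v).card := Finset.card_le_card this
    rw [Finset.card_erase_of_mem hv] at h
    have : 0 < M.card := Finset.card_pos.2 ⟨v, hv⟩
    omega
  have hback : ∀ v ∈ M, 1 ≤ (nbrsIn G X v).card := fun v hv => Finset.card_pos.2 (hne v hv)
  have hfm : ∀ v ∈ M, m = 1 ∨ (m ≤ δ ∧ m ≤ l v + f v) := by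
    intro v hv
    have := hlm v hv
    rcases hsize with h | ⟨h1, h2⟩
    · left
      omega
    · have := h2 v hv
      have := hsplit v
      right
      omega
  set E : V → ℕ := fun v => min (m - 1) (m - l v) with hE
  -- the intervals of attainable sums
  have hK : ∀ k : Fin m, ∃ K : ℤ, (1 ≤ f (u k) → K + 1 ≤ E (u k)) ∧ (f (u k) = 0 → K = 0) ∧
      ∀ w, ClassBound G δ ε w (stage X u k) W → ∀ e ≤ E (u k), ∃ col,
        Admissible G δ ε w (stage X u k) W (u k) col ∧
        ∑ x ∈ nbrsIn G W (u k), (col x : ℤ) = K - e := by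
    intro k
    have h1 := hlm _ (huMem k)
    have h2 := hsplit (u k)
    have h3 := hback _ (huMem k)
    have h4 := hfm _ (huMem k)
    have h5 := hdeg2 (u k)
    have h6 : (nbrsIn G W (u k)).card = f (u k) := rfl
    have h7 : E (u k) = min (m - 1) (m - l (u k)) := rfl
    refine exists_admissible hε hδ hdeg (stage X u k) W (u k) (E (u k)) (by omega) ?_
    by_cases he : ε = 1
    · have := hreg he (u k)
      omega
    · omega
  choose K hK1 hK0 hK using hK
  -- label the vertices such that `K` is antitone in the label
  set σ := Tuple.sort fun k => -K k with hσ
  have hanti : ∀ i j : Fin m, i ≤ j → K (σ j) ≤ K (σ i) := fun i j hij =>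
    neg_le_neg_iff.1 (Tuple.monotone_sort (fun k => -K k) hij)
  set p : Fin m → V := fun i => u (σ i) with hp
  have hpinj : Function.Injective p := hu.comp σ.injective
  have hpM : Set.range p = M := by rw [hp, ← huM]; exact σ.surjective.range_comp u
  have hpMem : ∀ i, p i ∈ M := fun i => huMem (σ i)
  set e : Fin m → ℕ := fun i =>
    (Finset.univ.filter fun j => ¬ G.Adj (p i) (p j) ∧ m ≤ i.val + j.val).card with he
  have hel : ∀ i, (Finset.univ.filter fun j => G.Adj (p i) (p j)).card = l (p i) := by
    intro i
    have := sum_nbrsIn_eq (G := G) p hpinj (p i) fun _ => 1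
    rw [hpM] at this
    simp only [Finset.sum_const, nsmul_eq_mul, mul_one] at this
    exact_mod_cast this.symm
  have heE : ∀ i, e i ≤ E (p i) := by
    intro i
    refine le_min ?_ ?_
    · have h1 : e i ≤ i.val := by
        rw [← card_fin_le_add i]
        exact Finset.card_le_card fun j hj =>
          Finset.mem_filter.2 ⟨Finset.mem_univ _, (Finset.mem_filter.1 hj).2.2⟩
      have := i.isLt
      omega
    · have h1 : e i ≤ (Finset.univ.filter fun j => ¬ G.Adj (p i) (p j)).card :=
        Finset.card_le_card fun j hj =>
          Finset.mem_filter.2 ⟨Finset.mem_univ _, (Finset.mem_filter.1 hj).2.1⟩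
      have h2 := Finset.card_filter_add_card_filter_not (s := (Finset.univ : Finset (Fin m)))
        fun j => G.Adj (p i) (p j)
      rw [hel, Finset.card_univ, Fintype.card_fin] at h2
      omega
  have hpσ : ∀ k, p (σ.symm k) = u k := fun k => by simp [hp]
  obtain ⟨w₁, hs, hag, hC', hD', hy⟩ := exists_paint_sequence u hu huX huW
    (fun k => K k - e (σ.symm k)) (fun k w' hC' =>
      hK k w' hC' (e (σ.symm k)) (hpσ k ▸ heE (σ.symm k))) w hw hC
      (fun v hv => hD v (hWX v hv)) m le_rfl
  have hst : stage X u m = X ∪ M := by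
    rw [← huM]
    ext v
    simp [stage]
  rw [hst] at hC' hD'
  -- colour the edges inside the class
  obtain ⟨lab, hlab⟩ : ∃ lab : V → ℕ, ∀ i, lab (p i) = i.val :=
    ⟨Function.extend p (fun i => i.val) fun _ => 0, fun i => hpinj.extend_apply _ _ i⟩
  set w₂ : V → V → SignType := fun a b =>
    if a ∈ M ∧ b ∈ M then (if m ≤ lab a + lab b then -1 else 0) else w₁ a b with hw₂
  have hw₂' : ∀ a b, (a ∉ M ∨ b ∉ M) → w₂ a b = w₁ a b := fun a b h => by
    simp only [hw₂]
    rw [if_neg (by tauto)]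
  have hback2 : ∀ a ∈ X, ∀ b, w₂ a b = w a b := by
    intro a ha b
    have haM : a ∉ M := fun h => Set.disjoint_left.1 hXM ha h
    rw [hw₂' a b (Or.inl haM)]
    refine hag a b (Or.inl ?_) (Or.inr fun h => hWX a h ha)
    rw [huM]
    exact haM
  have hs₂ : ∀ a b, w₂ a b = w₂ b a := fun a b => by
    simp only [hw₂, hs a b, add_comm (lab a), and_comm (a := a ∈ M)]
  have hout : ∀ x ∈ X ∪ M, ∀ v ∈ W, w₁ x v = w₂ x v := fun x _ v hv =>
    (hw₂' x v (Or.inr (hWM v hv))).symm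
  -- the weights
  have hsumM : ∀ i, ∑ x ∈ nbrsIn G (M : Set V) (p i), (w₂ (p i) x : ℤ) = -(i.val - e i : ℤ) := by
    intro i
    rw [← hpM, sum_nbrsIn_eq p hpinj]
    have h1 : ∀ j, (w₂ (p i) (p j) : ℤ) = -(if m ≤ i.val + j.val then 1 else 0) := by
      intro j
      simp only [hw₂, hpMem, and_self, if_true, hlab]
      split_ifs <;> rfl
    rw [Finset.sum_congr rfl fun j _ => h1 j, Finset.sum_neg_distrib, Finset.sum_boole,
      Finset.filter_filter]
    have h2 := Finset.card_filter_add_card_filter_not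
      (s := Finset.univ.filter fun j : Fin m => m ≤ i.val + j.val) fun j => G.Adj (p i) (p j)
    rw [card_fin_le_add, Finset.filter_filter, Finset.filter_filter] at h2
    have h3 : e i = (Finset.univ.filter fun j : Fin m =>
        m ≤ i.val + j.val ∧ ¬ G.Adj (p i) (p j)).card := by
      simp only [he, and_comm]
    have h4 : (Finset.univ.filter fun j : Fin m => G.Adj (p i) (p j) ∧ m ≤ i.val + j.val).card =
      (Finset.univ.filter fun j : Fin m => m ≤ i.val + j.val ∧ G.Adj (p i) (p j)).card := by
      simp only [and_comm]
    rw [← h3] at h2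
    rw [h4]
    omega
  have hsumW : ∀ i, ∑ x ∈ nbrsIn G W (p i), (w₂ (p i) x : ℤ) = K (σ i) - e i := by
    intro i
    have := hy (σ i) (σ i).isLt
    rw [Equiv.symm_apply_apply] at this
    rw [← this]
    refine Finset.sum_congr rfl fun x hx => ?_
    rw [hw₂' _ _ (Or.inr (hWM x (mem_nbrsIn.1 hx).2))]
  have hsumX : ∀ v ∈ M, ∑ x ∈ nbrsIn G X v, (w₂ v x : ℤ) =
      (nbrsIn G X v).card - deficit G w X v := by
    intro v _
    rw [deficit, Finset.sum_sub_distrib, Finset.sum_const, nsmul_eq_mul, mul_one, sub_sub_cancel]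
    exact Finset.sum_congr rfl fun x hx => by rw [hs₂, hback2 x (mem_nbrsIn.1 hx).2]
  have hwt : ∀ i, weight G w₂ (p i) =
      (nbrsIn G X (p i)).card - deficit G w X (p i) - i.val + K (σ i) := by
    intro i
    rw [weight, sum_neighborFinset_split hXM hW, hsumX _ (hpMem i), hsumM, hsumW]
    ring
  refine ⟨w₂, hs₂, hback2, hC'.congr hout, hD'.congr hout, fun v hv => ?_, fun v hv v' hv' h => ?_⟩
  · obtain ⟨i, rfl⟩ : v ∈ Set.range p := by rw [hpM]; exact hv
    rw [hwt]
    have h1 := hlm _ hv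
    have h2 := hsplit (p i)
    have h4 := hfm _ hv
    have h7 : E (p i) = min (m - 1) (m - l (p i)) := rfl
    have hdef : 0 ≤ deficit G w X (p i) := Finset.sum_nonneg fun x _ => by
      cases w x (p i) <;> decide
    rcases Nat.eq_zero_or_pos (f (p i)) with h0 | h0
    · -- all edges at `p i` lead to vertices processed earlier
      have h5 := hK0 (σ i) h0
      have h6 := hD (p i) (fun h => Set.disjoint_left.1 hXM h hv) (by omega)
      omega
    · have h5 := hK1 (σ i) h0
      change K (σ i) + 1 ≤ E (p i) at h5
      omega
  · obtain ⟨i, rfl⟩ : v ∈ Set.range p := by rw [hpM]; exact hv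
    obtain ⟨j, rfl⟩ : v' ∈ Set.range p := by rw [hpM]; exact hv'
    have hij := hsim _ hv _ hv'
    have hdef : deficit G w X (p i) = deficit G w X (p j) := by
      rw [deficit, deficit, ← hij.nbrsIn_eq]
      refine Finset.sum_congr rfl fun x hx => ?_
      rw [(hij.2 x (mem_nbrsIn.1 hx).2).2 (mem_nbrsIn.1 hx).1.symm]
    rw [hwt, hwt, hdef, hij.nbrsIn_eq] at h
    rcases lt_trichotomy i j with hlt | heq | hlt
    · have := hanti i j hlt.le
      have : i.val < j.val := hlt
      omega
    · rw [heq]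
    · have := hanti j i hlt.le
      have : j.val < i.val := hlt
      omega

end Run

/-! ### Exhausting the graph -/

theorem exists_adj_boundary {V : Type*} {G : SimpleGraph V} (hconn : G.Connected) {X : Set V}
    {v₀ : V} (h0 : v₀ ∈ X)
    (hX : X ≠ Set.univ) : ∃ x ∈ X, ∃ v ∉ X, G.Adj x v := by
  by_contra! hcon
  refine hX (Set.eq_univ_of_forall fun v => ?_)
  obtain ⟨p⟩ := hconn.preconnected v₀ v
  induction p with
  | nil => exact h0
  | cons ha _ ih =>
    by_contra hv
    exact hv (ih (by
      by_contra hb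
      exact hcon _ h0 _ hb ha))

section Exhaust
open Classical

variable {V : Type*} {G : SimpleGraph V} [G.LocallyFinite]

/-- `φ` preserves the colours of all edges. -/
def Preserves (w : V → V → SignType) (φ : G ≃g G) : Prop :=
  ∀ a b, G.Adj a b → w (φ a) (φ b) = w a b

theorem weight_congr {w w' : V → V → SignType} {v : V} (h : ∀ x, w v x = w' v x) :
    weight G w v = weight G w' v :=
  Finset.sum_congr rfl fun x _ => by rw [h]

theorem degree_map (φ : G ≃g G) (v : V) : G.degree (φ v) = G.degree v := by
  rw [← card_neighborFinset_eq_degree, ← card_neighborFinset_eq_degree]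
  refine (Finset.card_bij (fun x _ => φ x) (fun x hx => ?_) (fun x _ y _ h => φ.injective h)
    fun y hy => ⟨φ.symm y, ?_, by simp⟩).symm
  · rw [mem_neighborFinset] at hx ⊢
    exact φ.map_adj_iff.2 hx
  · rw [mem_neighborFinset] at hy ⊢
    rw [← φ.map_adj_iff]
    simpa using hy

theorem weight_map {w : V → V → SignType} {φ : G ≃g G} (h : Preserves w φ) (v : V) :
    weight G w (φ v) = weight G w v := by
  refine (Finset.sum_bij (fun x _ => φ x) (fun x hx => ?_) (fun x _ y _ h => φ.injective h)
    (fun y hy => ⟨φ.symm y, ?_, by simp⟩) fun x hx => ?_).symm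
  · rw [mem_neighborFinset] at hx ⊢
    exact φ.map_adj_iff.2 hx
  · rw [mem_neighborFinset] at hy ⊢
    rw [← φ.map_adj_iff]
    simpa using hy
  · rw [h v x (by simpa using hx)]

/-- The edges at the vertices of `X` have their final colours: they make the weight of the root
unlike that of the other vertices of `X` of the same degree, and every colour preserving
automorphism that fixes the root fixes `X` pointwise, however the remaining edges are coloured. -/
structure Settled (G : SimpleGraph V) [G.LocallyFinite] (ε : ℕ) (v₀ : V)
    (X : Set V) (w : V → V → SignType) : Prop where
  symm : ∀ a b, w a b = w b a
  root_mem : v₀ ∈ X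
  deficit_bound : DeficitBound G ε w X Xᶜ
  weight_root : weight G w v₀ + ε = G.degree v₀
  weight_le : ∀ v ∈ X, v ≠ v₀ → weight G w v + 1 + ε ≤ G.degree v
  rigid : ∀ w' : V → V → SignType, (∀ x ∈ X, ∀ y, w' x y = w x y) → ∀ φ : G ≃g G,
    Preserves w' φ → φ v₀ = v₀ → ∀ x ∈ X, φ x = x

theorem Settled.extend {δ ε : ℕ} (hε : ε ≤ 1) (hδ : 3 ≤ δ) (hdeg : ∀ v, δ ≤ G.degree v)
    (hdeg2 : ∀ v, G.degree v ≤ 2 * δ) (hreg : ε = 1 → ∀ v, G.degree v = δ) {v₀ : V}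
    {X : Set V} {w : V → V → SignType} (h : Settled G ε v₀ X w)
    (M : Finset V) (hXM : Disjoint X M) (hsim : ∀ v ∈ M, ∀ v' ∈ M, Similar G w X v v')
    (hclosed : ∀ v ∈ M, ∀ v' ∉ X, Similar G w X v v' → v' ∈ M)
    (hne : ∀ v ∈ M, (nbrsIn G X v).Nonempty)
    (hsize : M.card ≤ 1 ∨ (M.card ≤ δ ∧ ∀ v ∈ M, M.card + (nbrsIn G X v).card ≤ G.degree v))
    (hC : ClassBound G δ ε w X (X ∪ M)ᶜ) :
    ∃ w' : V → V → SignType, (∀ a ∈ X, ∀ b, w' a b = w a b) ∧ Settled G ε v₀ (X ∪ M) w' ∧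
      ClassBound G δ ε w' (X ∪ M) (X ∪ M)ᶜ := by
  obtain ⟨w', hs, hag, hC', hD', hle, hinj⟩ := exists_process_class hε hδ hdeg hdeg2 hreg X M hXM w
    h.symm hsim hne hsize hC h.deficit_bound
  refine ⟨w', hag, ⟨hs, Or.inl h.root_mem, hD', ?_, ?_, ?_⟩, hC'⟩
  · rw [weight_congr (hag v₀ h.root_mem)]
    exact h.weight_root
  · rintro v (hv | hv) hv0
    · rw [weight_congr (hag v hv)]
      exact h.weight_le v hv hv0
    · exact hle v hv
  · intro w'' hw'' φ hφ h0
    have hX : ∀ x ∈ X, φ x = x := h.rigid w'' (fun x hx y => by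
      rw [hw'' x (Or.inl hx), hag x hx]) φ hφ h0
    rintro v (hv | hv)
    · exact hX v hv
    · have hvX : φ v ∉ X := fun hvX => by
        have : v = φ v := (φ.injective (hX _ hvX)).symm
        exact Set.disjoint_left.1 hXM (this ▸ hvX) hv
      have hsimv : Similar G w X v (φ v) := by
        refine ⟨(degree_map φ v).symm, fun x hx => ⟨?_, fun ha => ?_⟩⟩
        · rw [← φ.map_adj_iff, hX x hx]
        · have := hφ x v ha
          rw [hX x hx, hw'' x (Or.inl hx), hw'' x (Or.inl hx), hag x hx, hag x hx] at this
          exact this.symm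
      have hM : φ v ∈ M := hclosed v hv _ hvX hsimv
      refine hinj _ hM v hv ?_
      rw [← weight_congr (hw'' _ (Or.inr hM)), ← weight_congr (hw'' _ (Or.inr hv)),
        weight_map hφ]

/-- Any unprocessed vertex with a processed neighbour belongs to a finite class of similar
vertices, which can be processed next. -/
theorem Settled.exists_bigger {δ ε : ℕ} (hconn : G.Connected) (hε : ε ≤ 1) (hδ : 3 ≤ δ)
    (hdeg : ∀ v, δ ≤ G.degree v)
    (hdeg2 : ∀ v, G.degree v ≤ 2 * δ) (hreg : ε = 1 → ∀ v, G.degree v = δ) {v₀ : V}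
    {X : Set V} {w : V → V → SignType} (h : Settled G ε v₀ X w) (hC : ClassBound G δ ε w X Xᶜ)
    (hX : X ≠ Set.univ) :
    ∃ (X' : Set V) (w' : V → V → SignType), X ⊆ X' ∧ ¬ X' ⊆ X ∧ (∀ a ∈ X, ∀ b, w' a b = w a b) ∧
      Settled G ε v₀ X' w' ∧ ClassBound G δ ε w' X' X'ᶜ := by
  obtain ⟨x, hx, v, hv, hxv⟩ := exists_adj_boundary hconn h.root_mem hX
  set M := (G.neighborFinset x).filter fun v' => v' ∉ X ∧ Similar G w X v v' with hM
  have hmem : ∀ v', v' ∉ X → Similar G w X v v' → v' ∈ M := fun v' h1 h2 =>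
    Finset.mem_filter.2 ⟨(mem_neighborFinset _ _ _).2 ((h2.2 x hx).1.1 hxv), h1, h2⟩
  have hMX : ∀ v' ∈ M, v' ∉ X := fun v' hv' => (Finset.mem_filter.1 hv').2.1
  have hMs : ∀ v' ∈ M, Similar G w X v v' := fun v' hv' => (Finset.mem_filter.1 hv').2.2
  have hne : (nbrsIn G X v).Nonempty := ⟨x, mem_nbrsIn.2 ⟨hxv.symm, hx⟩⟩
  have hcard := hC v hv hne M fun t ht => ⟨hMX t ht, hMs t ht⟩
  obtain ⟨w', hag, hS, hC'⟩ := h.extend hε hδ hdeg hdeg2 hreg M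
    (Set.disjoint_right.2 hMX)
    (fun a ha b hb => (hMs a ha).symm.trans (hMs b hb))
    (fun a ha b hb hab => hmem b hb ((hMs a ha).trans hab))
    (fun a ha => (hMs a ha).nbrsIn_eq ▸ hne) (by
      by_cases h1 : M.card ≤ 1
      · exact Or.inl h1
      · refine Or.inr ⟨by omega, fun a ha => ?_⟩
        rw [← (hMs a ha).nbrsIn_eq]
        have := hdeg a
        omega)
    fun a ha hn T hT => hC a (fun h' => ha (Or.inl h')) hn T fun t ht =>
      ⟨fun h' => (hT t ht).1 (Or.inl h'), (hT t ht).2⟩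
  exact ⟨X ∪ M, w', Set.subset_union_left, fun hs => hv (hs (Or.inr (hmem v hv
    (Similar.refl w X v)))), hag, hS, hC'⟩

/-- By Zorn's lemma the processing of classes can be continued until all vertices are processed. -/
theorem Settled.exists_univ {δ ε : ℕ} (hconn : G.Connected) (hε : ε ≤ 1) (hδ : 3 ≤ δ)
    (hdeg : ∀ v, δ ≤ G.degree v)
    (hdeg2 : ∀ v, G.degree v ≤ 2 * δ) (hreg : ε = 1 → ∀ v, G.degree v = δ) {v₀ : V}
    {X : Set V} {w : V → V → SignType} (h : Settled G ε v₀ X w) (hC : ClassBound G δ ε w X Xᶜ) :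
    ∃ w', Settled G ε v₀ Set.univ w' := by
  let P := {s : Set V × (V → V → SignType) //
    Settled G ε v₀ s.1 s.2 ∧ ClassBound G δ ε s.2 s.1 s.1ᶜ}
  let r : P → P → Prop := fun a b => a.1.1 ⊆ b.1.1 ∧ ∀ x ∈ a.1.1, ∀ y, b.1.2 x y = a.1.2 x y
  have : Nonempty P := ⟨⟨(X, w), h, hC⟩⟩
  have hchain : ∀ c : Set P, IsChain r c → c.Nonempty → ∃ ub, ∀ a ∈ c, r a ub := by
    intro c hc hcne
    have htot : ∀ a ∈ c, ∀ b ∈ c, r a b ∨ r b a := fun a ha b hb => by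
      by_cases hab : a = b
      · exact Or.inl (hab ▸ ⟨subset_rfl, fun _ _ _ => rfl⟩)
      · exact hc ha hb hab
    set U : Set V := {x | ∃ a ∈ c, x ∈ a.1.1} with hU
    choose! i hic hix using fun x (hx : x ∈ U) => hx
    -- the common colouring of the edges at the union
    set W : V → V → SignType := fun x y =>
      if x ∈ U then (i x).1.2 x y else if y ∈ U then (i y).1.2 y x else 0 with hW
    have hWa : ∀ a ∈ c, ∀ x ∈ a.1.1, ∀ y, W x y = a.1.2 x y := by
      intro a ha x hx y
      have hxU : x ∈ U := ⟨a, ha, hx⟩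
      simp only [hW, hxU, if_true]
      rcases htot a ha (i x) (hic x hxU) with h1 | h1
      · exact h1.2 x hx y
      · exact (h1.2 x (hix x hxU) y).symm
    have hsub : ∀ a ∈ c, a.1.1 ⊆ U := fun a ha x hx => ⟨a, ha, hx⟩
    have hfin : ∀ A : Finset V, (∀ x ∈ A, x ∈ U) → ∃ a ∈ c, ∀ x ∈ A, x ∈ a.1.1 := by
      intro A
      induction A using Finset.induction_on with
      | empty =>
        intro _
        obtain ⟨a, ha⟩ := hcne
        exact ⟨a, ha, by simp⟩
      | insert y A _ ih =>
        intro hA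
        obtain ⟨a, ha, hAa⟩ := ih fun x hx => hA x (Finset.mem_insert_of_mem hx)
        obtain ⟨b, hb, hyb⟩ := hA y (Finset.mem_insert_self y A)
        rcases htot a ha b hb with h1 | h1
        · exact ⟨b, hb, fun x hx => (Finset.mem_insert.1 hx).elim (fun h => h ▸ hyb)
            fun h => h1.1 (hAa x h)⟩
        · exact ⟨a, ha, fun x hx => (Finset.mem_insert.1 hx).elim (fun h => h ▸ h1.1 hyb)
            fun h => hAa x h⟩
    have hloc : ∀ v, ∃ a ∈ c, nbrsIn G U v = nbrsIn G a.1.1 v := by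
      intro v
      obtain ⟨a, ha, hva⟩ := hfin (nbrsIn G U v) fun x hx => (mem_nbrsIn.1 hx).2
      refine ⟨a, ha, ?_⟩
      ext x
      exact ⟨fun hx => mem_nbrsIn.2 ⟨(mem_nbrsIn.1 hx).1, hva x hx⟩, fun hx =>
        mem_nbrsIn.2 ⟨(mem_nbrsIn.1 hx).1, hsub a ha (mem_nbrsIn.1 hx).2⟩⟩
    obtain ⟨a₀, ha₀⟩ := hcne
    refine ⟨⟨(U, W), ⟨?_, ?_, ?_, ?_, ?_, ?_⟩, ?_⟩, fun a ha => ⟨hsub a ha, hWa a ha⟩⟩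
    · intro x y
      change W x y = W y x
      by_cases hx : x ∈ U
      · obtain ⟨a, ha, hxa⟩ := hx
        by_cases hy : y ∈ U
        · obtain ⟨b, hb, hyb⟩ := hy
          rcases htot a ha b hb with h1 | h1
          · rw [hWa b hb x (h1.1 hxa), hWa b hb y hyb, b.2.1.symm]
          · rw [hWa a ha x hxa, hWa a ha y (h1.1 hyb), a.2.1.symm]
        · have hxU : x ∈ U := ⟨a, ha, hxa⟩
          simp only [hW, hxU, hy, if_true, if_false]
      · by_cases hy : y ∈ U <;> simp only [hW, hx, hy, if_true, if_false]
    · exact ⟨a₀, ha₀, a₀.2.1.root_mem⟩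
    · intro v hv hdegv
      obtain ⟨a, ha, hva⟩ := hloc v
      change v ∉ U at hv
      change G.degree v ≤ (nbrsIn G U v).card + ε at hdegv
      have h1 : deficit G W U v = deficit G a.1.2 a.1.1 v := by
        rw [deficit, hva]
        exact deficit_congr fun x hx => hWa a ha x hx v
      change _ ≤ deficit G W U v
      rw [h1]
      change _ + ((nbrsIn G U v).card : ℤ) - _ ≤ _
      rw [hva] at hdegv ⊢
      exact a.2.1.deficit_bound v (fun h => hv (hsub a ha h)) hdegv
    · rw [weight_congr (hWa a₀ ha₀ v₀ a₀.2.1.root_mem)]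
      exact a₀.2.1.weight_root
    · rintro v ⟨a, ha, hva⟩ hv0
      rw [weight_congr (hWa a ha v hva)]
      exact a.2.1.weight_le v hva hv0
    · rintro w' hw' φ hφ h0 x ⟨a, ha, hxa⟩
      exact a.2.1.rigid w' (fun z hz y =>
        (hw' z (hsub a ha hz) y).trans (hWa a ha z hz y)) φ hφ h0 x hxa
    · intro v hv hne T hT
      obtain ⟨a, ha, hva⟩ := hloc v
      change v ∉ U at hv
      change (nbrsIn G U v).Nonempty at hne
      change _ ≤ max 1 (δ - ε - (nbrsIn G U v).card)
      rw [hva] at hne ⊢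
      refine a.2.2 v (fun h => hv (hsub a ha h)) hne T fun t ht =>
        ⟨fun h => (hT t ht).1 (hsub a ha h), ((hT t ht).2.mono (hsub a ha)).congr
          (fun x hx => hWa a ha x hx v) fun x hx => hWa a ha x hx t⟩
  obtain ⟨m, hm⟩ := exists_maximal_of_nonempty_chains_bounded hchain
    fun {a b c} hab hbc => ⟨hab.1.trans hbc.1, fun x hx y => by
      rw [hbc.2 x (hab.1 hx), hab.2 x hx]⟩
  by_cases hmu : m.1.1 = Set.univ
  · exact ⟨m.1.2, hmu ▸ m.2.1⟩
  · obtain ⟨X', w', h1, h2, h3, h4, h5⟩ := m.2.1.exists_bigger hconn hε hδ hdeg hdeg2 hreg m.2.2 hmu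
    exact absurd (hm ⟨(X', w'), h4, h5⟩ ⟨h1, h3⟩).1 h2

/-- If the colours at the root and a first class `M` of neighbours of the root are chosen suitably,
then the colouring can be completed. The members of `M` need not satisfy `ClassBound`, which is only
used for the vertices that remain after a class has been processed; for `M` itself `hsize` is
enough. -/
theorem exists_preserves_imp_fix {δ ε : ℕ} (hconn : G.Connected) (hε : ε ≤ 1) (hδ : 3 ≤ δ)
    (hdeg : ∀ v, δ ≤ G.degree v)
    (hdeg2 : ∀ v, G.degree v ≤ 2 * δ) (hreg : ε = 1 → ∀ v, G.degree v = δ) (v₀ : V)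
    (w : V → V → SignType) (hw : ∀ a b, w a b = w b a) (hwt : weight G w v₀ + ε = G.degree v₀)
    (M : Finset V) (hM : ∀ v ∈ M, G.Adj v₀ v)
    (hsim : ∀ v ∈ M, ∀ v' ∈ M, Similar G w {v₀} v v')
    (hclosed : ∀ v ∈ M, ∀ v', Similar G w {v₀} v v' → v' ∈ M)
    (hsize : M.card ≤ δ ∧ ∀ v ∈ M, M.card + 1 ≤ G.degree v)
    (hrest : (G.neighborFinset v₀ \ M).card ≤ max 1 (δ - ε - 1)) :
    ∃ w' : V → V → SignType, (∀ a b, w' a b = w' b a) ∧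
      ∀ φ : G ≃g G, Preserves w' φ → ∀ v, φ v = v := by
  have hnb : ∀ v, (nbrsIn G {v₀} v).card ≤ 1 := fun v =>
    Finset.card_le_one.2 fun a ha b hb => by
      have h1 : a = v₀ := (mem_nbrsIn.1 ha).2
      have h2 : b = v₀ := (mem_nbrsIn.1 hb).2
      rw [h1, h2]
  have h0 : Settled G ε v₀ {v₀} w := by
    refine ⟨hw, rfl, fun v _ h => ?_, hwt, fun v hv hv0 => absurd hv hv0, ?_⟩
    · have := hnb v
      have := hdeg v
      omega
    · rintro w' - φ - h x rfl
      exact h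
  obtain ⟨w₁, -, h1, hC1⟩ := h0.extend hε hδ hdeg hdeg2 hreg M
    (Set.disjoint_left.2 fun x hx hxM => by
      rw [Set.mem_singleton_iff.1 hx] at hxM
      exact (hM v₀ hxM).ne rfl)
    hsim (fun v hv v' _ h => hclosed v hv v' h)
    (fun v hv => ⟨v₀, mem_nbrsIn.2 ⟨(hM v hv).symm, rfl⟩⟩)
    (Or.inr ⟨hsize.1, fun v hv => by
      have := hnb v
      have := hsize.2 v hv
      omega⟩) (by
      intro v hv hne T hT
      have hc : (nbrsIn G {v₀} v).card = 1 := le_antisymm (hnb v) hne.card_pos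
      rw [hc]
      refine (Finset.card_le_card fun t ht => ?_).trans hrest
      obtain ⟨x, hx⟩ := hne
      have hxv : x = v₀ := (mem_nbrsIn.1 hx).2
      have hadj := ((hT t ht).2.2 v₀ rfl).1.1 (hxv ▸ (mem_nbrsIn.1 hx).1.symm)
      exact Finset.mem_sdiff.2 ⟨(mem_neighborFinset _ _ _).2 hadj,
        fun h => (hT t ht).1 (Or.inr h)⟩)
  obtain ⟨w', hS⟩ := h1.exists_univ hconn hε hδ hdeg hdeg2 hreg hC1
  refine ⟨w', hS.symm, fun φ hφ v => ?_⟩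
  have hroot : φ v₀ = v₀ := by
    by_contra hne
    have h2 := hS.weight_le (φ v₀) (Set.mem_univ _) hne
    rw [weight_map hφ, degree_map] at h2
    have := hS.weight_root
    omega
  exact hS.rigid w' (fun _ _ _ => rfl) φ hφ hroot v (Set.mem_univ v)

theorem exists_rigid_of_three_le {δ : ℕ} (hconn : G.Connected) (hδ : 3 ≤ δ)
    (hdeg : ∀ v, δ ≤ G.degree v) (hdeg2 : ∀ v, G.degree v ≤ 2 * δ) (hex : ∃ v, G.degree v = δ) :
    ∃ w : V → V → SignType, (∀ a b, w a b = w b a) ∧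
      ∀ φ : G ≃g G, Preserves w φ → ∀ v, φ v = v := by
  obtain ⟨v₁, hv₁⟩ := hex
  by_cases hreg : {v | G.degree v = δ} = Set.univ
  · -- a regular graph: the root has exactly one edge of sign `0`, all others have sign `1`
    have hreg : ∀ v, G.degree v = δ := fun v => by
      have : v ∈ {v | G.degree v = δ} := hreg ▸ Set.mem_univ v
      exact this
    obtain ⟨u, hu⟩ : (G.neighborFinset v₁).Nonempty := by
      rw [← Finset.card_pos, card_neighborFinset_eq_degree]
      omega
    have hau : G.Adj v₁ u := (mem_neighborFinset _ _ _).1 hu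
    set w : V → V → SignType := fun a b =>
      if (a = v₁ ∧ b = u) ∨ (a = u ∧ b = v₁) then 0 else 1 with hw
    have hwu : w v₁ u = 0 := by simp [hw]
    have hwx : ∀ x, x ≠ u → w v₁ x = 1 := fun x hx => by
      simp only [hw]
      rw [if_neg]
      rintro (⟨-, h⟩ | ⟨h, -⟩)
      · exact hx h
      · exact hau.ne h
    refine exists_preserves_imp_fix (ε := 1) hconn le_rfl hδ hdeg hdeg2 (fun _ => hreg) v₁ w ?_ ?_
      ((G.neighborFinset v₁).erase u) ?_ ?_ ?_ ?_ ?_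
    · intro a b
      simp only [hw]
      congr 1
      exact propext ⟨fun h => h.elim (fun h => Or.inr ⟨h.2, h.1⟩) fun h => Or.inl ⟨h.2, h.1⟩,
        fun h => h.elim (fun h => Or.inr ⟨h.2, h.1⟩) fun h => Or.inl ⟨h.2, h.1⟩⟩
    · rw [weight, ← Finset.add_sum_erase _ _ hu, hwu,
        Finset.sum_congr rfl fun x hx => by rw [hwx x (Finset.ne_of_mem_erase hx)]]
      rw [Finset.sum_const, Finset.card_erase_of_mem hu, card_neighborFinset_eq_degree, hreg]
      have : ((1 : SignType) : ℤ) = 1 := rfl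
      have h0 : ((0 : SignType) : ℤ) = 0 := rfl
      rw [this, h0]
      simp only [nsmul_eq_mul, mul_one]
      omega
    · exact fun v hv => (mem_neighborFinset _ _ _).1 (Finset.mem_of_mem_erase hv)
    · intro v hv v' hv'
      refine ⟨by rw [hreg, hreg], ?_⟩
      rintro x rfl
      exact ⟨⟨fun _ => (mem_neighborFinset _ _ _).1 (Finset.mem_of_mem_erase hv'),
        fun _ => (mem_neighborFinset _ _ _).1 (Finset.mem_of_mem_erase hv)⟩, fun _ => by
        rw [hwx v (Finset.ne_of_mem_erase hv), hwx v' (Finset.ne_of_mem_erase hv')]⟩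
    · intro v hv v' h
      have hadj : G.Adj v₁ v := (mem_neighborFinset _ _ _).1 (Finset.mem_of_mem_erase hv)
      refine Finset.mem_erase.2 ⟨fun hvu => ?_, (mem_neighborFinset _ _ _).2
        ((h.2 v₁ rfl).1.1 hadj)⟩
      have := (h.2 v₁ rfl).2 hadj
      rw [hwx v (Finset.ne_of_mem_erase hv), hvu, hwu] at this
      exact absurd this (by decide)
    · rw [Finset.card_erase_of_mem hu, card_neighborFinset_eq_degree, hreg]
      exact ⟨by omega, fun v _ => by rw [hreg]; omega⟩
    · refine le_max_of_le_left ?_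
      rw [Finset.sdiff_erase_self hu, Finset.card_singleton]
  · -- otherwise all edges at the root have sign `1`, and its neighbours differ in degree or have
    -- larger degrees than the root
    obtain ⟨v₀, hv₀, u, hu, hau⟩ := exists_adj_boundary hconn
      (show v₁ ∈ {v | G.degree v = δ} from hv₁) hreg
    change G.degree v₀ = δ at hv₀
    change ¬ G.degree u = δ at hu
    have hune := hdeg u
    refine exists_preserves_imp_fix (ε := 0) hconn zero_le_one hδ hdeg hdeg2
      (fun h => absurd h zero_ne_one) v₀ (fun _ _ => 1) (fun _ _ => rfl) ?_
      ((G.neighborFinset v₀).filter fun x => G.degree x = G.degree u) ?_ ?_ ?_ ?_ ?_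
    · simp [weight]
    · exact fun v hv => (mem_neighborFinset _ _ _).1 (Finset.mem_filter.1 hv).1
    · intro v hv v' hv'
      refine ⟨(Finset.mem_filter.1 hv).2.trans (Finset.mem_filter.1 hv').2.symm, ?_⟩
      rintro x rfl
      exact ⟨⟨fun _ => (mem_neighborFinset _ _ _).1 (Finset.mem_filter.1 hv').1,
        fun _ => (mem_neighborFinset _ _ _).1 (Finset.mem_filter.1 hv).1⟩, fun _ => rfl⟩
    · intro v hv v' h
      have hadj := (mem_neighborFinset _ _ _).1 (Finset.mem_filter.1 hv).1
      exact Finset.mem_filter.2 ⟨(mem_neighborFinset _ _ _).2 ((h.2 v₀ rfl).1.1 hadj),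
        h.1.symm.trans (Finset.mem_filter.1 hv).2⟩
    · have hle : ((G.neighborFinset v₀).filter fun x => G.degree x = G.degree u).card ≤ δ :=
        (Finset.card_filter_le _ _).trans (by rw [card_neighborFinset_eq_degree, hv₀])
      refine ⟨hle, fun v hv => ?_⟩
      rw [(Finset.mem_filter.1 hv).2]
      omega
    · refine le_max_of_le_right ((Finset.card_le_card (t := (G.neighborFinset v₀).erase u)
        fun x hx => ?_).trans ?_)
      · obtain ⟨h1, h2⟩ := Finset.mem_sdiff.1 hx
        refine Finset.mem_erase.2 ⟨?_, h1⟩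
        rintro rfl
        exact h2 (Finset.mem_filter.2 ⟨h1, rfl⟩)
      · rw [Finset.card_erase_of_mem ((mem_neighborFinset _ _ _).2 hau),
          card_neighborFinset_eq_degree, hv₀]
        omega

end Exhaust

/-! ### Minimum degree at most two -/

section SmallDegree
open Classical

variable {V : Type*} {G : SimpleGraph V}

theorem nonempty_iso_top_of_adj_leaves [G.LocallyFinite] (hconn : G.Connected) {a b : V}
    (hab : G.Adj a b) (ha : G.degree a = 1) (hb : G.degree b = 1) :
    Nonempty (G ≃g (⊤ : SimpleGraph (Fin 2))) := by
  have honly : ∀ {x y z : V}, G.degree x = 1 → G.Adj x y → G.Adj x z → z = y := by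
    intro x y z hx hy hz
    rw [← card_neighborFinset_eq_degree] at hx
    exact Finset.card_le_one.1 hx.le z ((mem_neighborFinset _ _ _).2 hz) y
      ((mem_neighborFinset _ _ _).2 hy)
  have huniv : ({a, b} : Set V) = Set.univ := by
    by_contra hne
    obtain ⟨x, hx, y, hy, hxy⟩ := exists_adj_boundary hconn (Set.mem_insert a {b}) hne
    rcases hx with rfl | hx
    · exact hy (Or.inr (honly ha hab hxy))
    · rw [Set.mem_singleton_iff.1 hx] at hxy
      exact hy (Or.inl (honly hb hab.symm hxy))
  have hx : ∀ x, x = a ∨ x = b := fun x => by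
    have : x ∈ ({a, b} : Set V) := huniv ▸ Set.mem_univ x
    simpa using this
  refine ⟨⟨⟨fun x => if x = a then 0 else 1, fun i => if i = 0 then a else b, fun x => ?_,
    fun i => ?_⟩, fun {x y} => ?_⟩⟩
  · rcases hx x with rfl | rfl <;> simp [hab.ne']
  · fin_cases i <;> simp [hab.ne']
  · rcases hx x with rfl | rfl <;> rcases hx y with rfl | rfl <;>
      simp [hab.ne', hab, hab.symm]

variable (G)

/-- The neighbours of `v` that are closer to `v₀`. -/
def upper (v₀ v : V) : Set V := {x | G.Adj v x ∧ G.dist v₀ x + 1 = G.dist v₀ v}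

/-- A neighbour of `v` closer to `v₀`, if there is one. It depends only on the set of all these
neighbours, so it is respected by automorphisms that fix this set pointwise. -/
noncomputable def parent (v₀ v : V) : V :=
  if h : (upper G v₀ v).Nonempty then h.some else v₀

/-- The vertices different from `v₀` whose parent is `p`. -/
noncomputable def children [G.LocallyFinite] (v₀ p : V) : Finset V :=
  (G.neighborFinset p).filter fun v => v ≠ v₀ ∧ parent G v₀ v = p

/-- The colouring that uses `col p` on the edges from `p` to its children and `-1` on all other
edges. -/
noncomputable def treeColoring (v₀ : V) (col : V → V → SignType) (a b : V) : SignType :=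
  if b ≠ v₀ ∧ parent G v₀ b = a then col a b
  else if a ≠ v₀ ∧ parent G v₀ a = b then col b a else -1

variable {G}

theorem upper_nonempty (hconn : G.Connected) {v₀ v : V} (hv : v ≠ v₀) :
    (upper G v₀ v).Nonempty := by
  obtain ⟨p, hp⟩ := hconn.exists_walk_length_eq_dist v v₀
  cases p with
  | nil => exact absurd rfl hv
  | cons h q =>
    rename_i x
    have h1 : G.dist x v₀ ≤ q.length := dist_le q
    have h2 : G.dist v v₀ ≤ G.dist x v₀ + 1 := by
      have := hconn.dist_triangle (u := v) (v := x) (w := v₀)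
      rw [dist_eq_one_iff_adj.2 h] at this
      omega
    rw [Walk.length_cons] at hp
    refine ⟨x, h, ?_⟩
    rw [dist_comm (u := v₀) (v := x), dist_comm (u := v₀) (v := v)]
    omega

theorem parent_mem_upper (hconn : G.Connected) {v₀ v : V} (hv : v ≠ v₀) :
    parent G v₀ v ∈ upper G v₀ v := by
  rw [parent, dif_pos (upper_nonempty hconn hv)]
  exact (upper_nonempty hconn hv).some_mem

theorem exists_rigid_of_le_two [G.LocallyFinite] {δ : ℕ} (hconn : G.Connected) (hδ : δ ≤ 2)
    (hdeg2 : ∀ v, G.degree v ≤ 2 * δ) (hex : ∃ v, G.degree v = δ)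
    (hK₂ : ¬ Nonempty (G ≃g (⊤ : SimpleGraph (Fin 2)))) :
    ∃ w : V → V → SignType, (∀ a b, w a b = w b a) ∧
      ∀ φ : G ≃g G, Preserves w φ → ∀ v, φ v = v := by
  obtain ⟨v₀, hv₀⟩ := hex
  have hpar : ∀ {v}, v ≠ v₀ → G.Adj v (parent G v₀ v) ∧
      G.dist v₀ (parent G v₀ v) + 1 = G.dist v₀ v := fun hv => parent_mem_upper hconn hv
  have hmem : ∀ {v}, v ≠ v₀ → v ∈ children G v₀ (parent G v₀ v) := fun hv =>
    Finset.mem_filter.2 ⟨(mem_neighborFinset _ _ _).2 (hpar hv).1.symm, hv, rfl⟩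
  have hcard : ∀ p, p ≠ v₀ → (children G v₀ p).card + 1 ≤ G.degree p := by
    intro p hp
    have hnot : parent G v₀ p ∉ children G v₀ p := fun h => by
      obtain ⟨-, h1, h2⟩ := Finset.mem_filter.1 h
      have h3 := (hpar h1).2
      rw [h2] at h3
      have h4 := (hpar hp).2
      omega
    rw [← Finset.card_insert_of_notMem hnot, ← card_neighborFinset_eq_degree]
    exact Finset.card_le_card (Finset.insert_subset ((mem_neighborFinset _ _ _).2 (hpar hp).1)
      (Finset.filter_subset _ _))
  -- siblings get distinct colours; the root avoids `-1`, an only child of another vertex gets `-1`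
  have hcol : ∀ p, ∃ c : V → SignType,
      (∀ t, ((children G v₀ p).filter fun v => c v = t).card ≤ 1) ∧
      (p = v₀ → ∀ v ∈ children G v₀ p, c v ≠ -1) ∧
      (p ≠ v₀ → (children G v₀ p).card ≤ 1 → ∀ v ∈ children G v₀ p, c v = -1) := by
    intro p
    by_cases hp : p = v₀
    · have h2 : (children G v₀ p).card ≤ 2 :=
        (Finset.card_filter_le _ _).trans (by rw [card_neighborFinset_eq_degree, hp, hv₀]; exact hδ)
      obtain ⟨c, h1, h2, h3, -⟩ := exists_signs_card (children G v₀ p)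
        (min (children G v₀ p).card 1) 0 (by omega)
      refine ⟨c, fun t => ?_, fun _ v hv hc => ?_, fun h => absurd hp h⟩
      · cases t
        · change ((children G v₀ p).filter fun v => c v = 0).card ≤ 1
          omega
        · change ((children G v₀ p).filter fun v => c v = -1).card ≤ 1
          omega
        · change ((children G v₀ p).filter fun v => c v = 1).card ≤ 1
          omega
      · have : v ∈ (children G v₀ p).filter fun v => c v = -1 := Finset.mem_filter.2 ⟨hv, hc⟩
        rw [Finset.card_eq_zero.1 h2] at this
        simp at this
    · have h2 := hcard p hp
      have h3 := hdeg2 p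
      obtain ⟨c, h1, h2, h3, -⟩ := exists_signs_card (children G v₀ p)
        (min ((children G v₀ p).card - 1) 1) (min (children G v₀ p).card 1) (by omega)
      refine ⟨c, fun t => ?_, fun h => absurd h hp, fun _ h v hv => ?_⟩
      · cases t
        · change ((children G v₀ p).filter fun v => c v = 0).card ≤ 1
          omega
        · change ((children G v₀ p).filter fun v => c v = -1).card ≤ 1
          omega
        · change ((children G v₀ p).filter fun v => c v = 1).card ≤ 1
          omega
      · have := (Finset.filter_card_eq (s := children G v₀ p) (p := fun v => c v = -1) (by omega))
        exact this v hv
  choose col hinj hroot honly using hcol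
  have hwl : ∀ {v}, v ≠ v₀ → treeColoring G v₀ col (parent G v₀ v) v = col (parent G v₀ v) v := by
    intro v hv
    exact if_pos ⟨hv, rfl⟩
  have hsymm : ∀ a b, treeColoring G v₀ col a b = treeColoring G v₀ col b a := by
    intro a b
    simp only [treeColoring]
    by_cases h1 : b ≠ v₀ ∧ parent G v₀ b = a
    · have h2 : ¬ (a ≠ v₀ ∧ parent G v₀ a = b) := by
        rintro ⟨h2, h3⟩
        have h4 := (hpar h1.1).2
        have h5 := (hpar h2).2
        rw [h1.2] at h4
        rw [h3] at h5
        omega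
      rw [if_pos h1, if_neg h2, if_pos h1]
    · rw [if_neg h1]
      by_cases h2 : a ≠ v₀ ∧ parent G v₀ a = b
      · rw [if_pos h2, if_pos h2]
      · rw [if_neg h2, if_neg h2, if_neg h1]
  have hv₀edge : ∀ y, G.Adj v₀ y → treeColoring G v₀ col v₀ y ≠ -1 := by
    intro y hy
    have h1 : parent G v₀ y = v₀ := by
      have h1 := (hpar hy.ne').2
      rw [dist_eq_one_iff_adj.2 hy] at h1
      exact (hconn.dist_eq_zero_iff.1 (by omega : G.dist v₀ (parent G v₀ y) = 0)).symm
    have h2 := hwl hy.ne'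
    have h3 := hmem hy.ne'
    rw [h1] at h2 h3
    rw [h2]
    exact hroot v₀ rfl y h3
  have hedge : ∀ v, v ≠ v₀ → G.degree v = δ → ∃ x, G.Adj v x ∧ treeColoring G v₀ col v x = -1 := by
    intro v hv hvδ
    have hpv := (hpar hv).1
    have hpos : 0 < G.degree v := (G.degree_pos_iff_exists_adj v).2 ⟨_, hpv⟩
    by_cases h1 : δ = 1
    · have hp : parent G v₀ v ≠ v₀ := fun h => by
        rw [h] at hpv
        exact hK₂ (nonempty_iso_top_of_adj_leaves hconn hpv (hvδ.trans h1) (hv₀.trans h1))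
      refine ⟨_, hpv, ?_⟩
      rw [hsymm, hwl hv]
      have := hcard _ hp
      have := hdeg2 (parent G v₀ v)
      exact honly _ hp (by omega) v (hmem hv)
    · have h2 : 1 < (G.neighborFinset v).card := by
        rw [card_neighborFinset_eq_degree]
        omega
      obtain ⟨x, hx, hxp⟩ := Finset.exists_mem_ne h2 (parent G v₀ v)
      refine ⟨x, (mem_neighborFinset _ _ _).1 hx, ?_⟩
      by_cases h3 : x ≠ v₀ ∧ parent G v₀ x = v
      · have h4 := hcard v hv
        rw [← h3.2, hwl h3.1]
        exact honly _ (by rw [h3.2]; exact hv) (by rw [h3.2]; omega) x (hmem h3.1)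
      · simp only [treeColoring]
        rw [if_neg h3, if_neg fun h => hxp h.2.symm]
  refine ⟨treeColoring G v₀ col, hsymm, fun φ hφ => ?_⟩
  have hfix : φ v₀ = v₀ := by
    by_contra hne
    obtain ⟨x, hx, hxc⟩ := hedge (φ v₀) hne (by rw [degree_map, hv₀])
    have hadj : G.Adj v₀ (φ.symm x) := by
      rw [← φ.map_adj_iff]
      simpa using hx
    refine hv₀edge _ hadj ?_
    rw [← hφ _ _ hadj]
    simpa using hxc
  have hdist : ∀ v, G.dist v₀ (φ v) = G.dist v₀ v := by
    have hle : ∀ (ψ : G ≃g G), ψ v₀ = v₀ → ∀ v, G.dist v₀ (ψ v) ≤ G.dist v₀ v := by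
      intro ψ hψ v
      obtain ⟨p, hp⟩ := hconn.exists_walk_length_eq_dist v₀ v
      have := dist_le (p.map ψ.toHom)
      rw [Walk.length_map, hp] at this
      have h0 : ψ.toHom v₀ = v₀ := hψ
      rw [h0] at this
      exact this
    intro v
    refine le_antisymm (hle φ hfix v) ?_
    have := hle φ.symm (by rw [RelIso.symm_apply_eq]; exact hfix.symm) (φ v)
    simpa using this
  have key : ∀ n v, G.dist v₀ v ≤ n → φ v = v := by
    intro n
    induction n with
    | zero =>
      intro v hv
      have : v₀ = v := hconn.dist_eq_zero_iff.1 (Nat.le_zero.1 hv)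
      rw [← this, hfix]
    | succ n ih =>
      intro v hv
      by_cases hv0 : v = v₀
      · rw [hv0, hfix]
      have hφv0 : φ v ≠ v₀ := fun h => hv0 (φ.injective (h.trans hfix.symm))
      have hup : upper G v₀ (φ v) = upper G v₀ v := by
        ext x
        simp only [upper, Set.mem_ofPred_eq, hdist]
        refine and_congr_left fun hx => ?_
        have hxx : φ x = x := ih x (by omega)
        conv_lhs => rw [← hxx]
        exact φ.map_adj_iff
      have hpp : parent G v₀ (φ v) = parent G v₀ v := by
        simp only [parent, hup]
      have hpfix : φ (parent G v₀ v) = parent G v₀ v := ih _ (by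
        have := (hpar hv0).2
        omega)
      have hc := hφ _ _ (hpar hv0).1.symm
      rw [hpfix, hwl hv0] at hc
      have h1 := hwl hφv0
      rw [hpp] at h1
      rw [h1] at hc
      have h2 := hmem hφv0
      rw [hpp] at h2
      exact Finset.card_le_one.1 (hinj (parent G v₀ v) (col (parent G v₀ v) v)) _
        (Finset.mem_filter.2 ⟨h2, hc⟩) _ (Finset.mem_filter.2 ⟨hmem hv0, rfl⟩)
  exact fun v => key _ v le_rfl

end SmallDegree

/-! ### From sign patterns to edge colourings -/

theorem exists_isAsymmetricEdgeColoring {V : Type*} {G : SimpleGraph V} {w : V → V → SignType}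
    (hw : ∀ a b, w a b = w b a) (h : ∀ φ : G ≃g G, Preserves w φ → ∀ v, φ v = v) :
    ∃ c : G.edgeSet → Fin 3, G.IsAsymmetricEdgeColoring c := by
  obtain ⟨f, hf⟩ : ∃ f : SignType → Fin 3, Function.Injective f :=
    ⟨SignType.fin3Equiv, SignType.fin3Equiv.injective⟩
  refine ⟨fun e => f (Sym2.lift ⟨w, hw⟩ e.1), fun φ hφ => ?_⟩
  ext v
  refine h φ (fun a b hab => ?_) v
  exact hf (hφ ⟨s(a, b), hab⟩)

end AsymmetricColoring
end SimpleGraph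

theorem theorem1 {V : Type*} (G : SimpleGraph V) [G.LocallyFinite] (hconn : G.Connected)
    (Δ δ : ℕ)
    (hΔ : IsGreatest (Set.range fun v : V => G.degree v) Δ)
    (hδ : IsLeast (Set.range fun v : V => G.degree v) δ)
    (hδΔ : (Δ : ℚ) / 2 ≤ (δ : ℚ))
    (hK₂ : ¬ Nonempty (G ≃g (⊤ : SimpleGraph (Fin 2)))) :
    (∃ c : G.edgeSet → Fin 3, G.IsAsymmetricEdgeColoring c) ∧ G.distinguishingIndex ≤ 3 := by
  have hle : Δ ≤ 2 * δ := by
    have : (Δ : ℚ) ≤ 2 * δ := by linarith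
    exact_mod_cast this
  have hdeg : ∀ v, δ ≤ G.degree v := fun v => hδ.2 ⟨v, rfl⟩
  have hdeg2 : ∀ v, G.degree v ≤ 2 * δ := fun v => (hΔ.2 ⟨v, rfl⟩).trans hle
  obtain ⟨w, hw, hrigid⟩ : ∃ w : V → V → SignType, (∀ a b, w a b = w b a) ∧
      ∀ φ : G ≃g G, SimpleGraph.AsymmetricColoring.Preserves w φ → ∀ v, φ v = v := by
    by_cases h3 : 3 ≤ δ
    · exact SimpleGraph.AsymmetricColoring.exists_rigid_of_three_le hconn h3 hdeg hdeg2 hδ.1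
    · exact SimpleGraph.AsymmetricColoring.exists_rigid_of_le_two hconn (by omega) hdeg2 hδ.1 hK₂
  obtain ⟨c, hc⟩ := SimpleGraph.AsymmetricColoring.exists_isAsymmetricEdgeColoring hw hrigid
  exact ⟨⟨c, hc⟩, sInf_le ⟨3, rfl, c, hc⟩⟩
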